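/- For real dimensions $D,m>0$ and $p,q\ge 0$ not both zero, let $$I_{D,m}(p,q)=\int\frac{d^mq'}{(2\pi)^m}\int\frac{d^Dp'}{(2\pi)^D}\,\frac{1}{p'^2+q'^4}\,\frac{1}{|\boldsymbol p'+\boldsymbol p|^2+|\boldsymbol q'+\boldsymbol q|^4},\qquad |\boldsymbol p|=p,\ |\boldsymbol q|=q .$$ Here, for an integrand $f(x,u)$ depending on $\boldsymbol k$ only through its component $x$ along a fixed axis (that of the external vector) and the squared length $u$ of its transverse part, the $N$-dimensional integral for real $N>0$ is $$\int d^Nk\,f:=-\frac{\pi^{(N-1)/2}}{\Gamma(\frac{N+1}{2})}\int_{-\infty}^{\infty}\!dx\int_0^\infty u^{(N-1)/2}\,\frac{\partial f}{\partial u}(x,u)\,du ,$$ i.e. the analytic continuation in $N$ (by one integration by parts) of the formula in polar coordinates of the transverse space, which is the Lebesgue integral over $\mathbb R^N$ for positive integers $N$. Let $0<D<2$ be fixed and put $m=4-2D+2\epsilon$, so that $\epsilon=D-2+\frac12 m$ is the distance of $d=D+m$ from the lower boundary $d_\ell=2+\frac12 m$ of the convergence domain. Then for all fixed $p,q\ge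 0$, not both zero, $$I_{D,m}(p,q)=\frac{E_D}{\epsilon\,(p^2+q^4)}+O(1)\qquad(\epsilon\to0+),\qquad E_D=\frac{4\,(16\pi)^{(D-3)/2}}{\Gamma(\frac32-\frac D2)} .$$ -/

import Mathlib

/-- The integral `∫ d^N k f(k)` in real (not necessarily integer) dimension `N`, for an integrand
that depends on the vector `k` only through its component `x` along a fixed axis and the square
`u = |k|² - x²` of the length of its transverse part, so `|k|² = x² + u`; the integrand is given
as the function `f x u`.

The transverse part ranges over an `(N-1)`-dimensional space, so in polar coordinates, with `S` the
area `2 π^((N-1)/2) / Γ((N-1)/2)` of its unit sphere,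
`∫ d^N k f = ∫_ℝ dx S ∫_0^∞ ρ^(N-2) f(x, ρ²) dρ
           = π^((N-1)/2) / Γ((N-1)/2) ∫_ℝ dx ∫_0^∞ u^((N-3)/2) f(x, u) du`   (`N > 1`),
and one integration by parts in `u` gives its analytic continuation in the dimension,
`- π^((N-1)/2) / Γ((N+1)/2) ∫_ℝ dx ∫_0^∞ u^((N-1)/2) ∂f/∂u (x, u) du`,
which makes sense for every `N > 0` (and is `∫_ℝ f(x, 0) dx` for `N = 1`). This is the definition
below. For positive integers `N` it is the Lebesgue integral over `ℝ^N`; in every dimension it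
gives `∫ d^N k exp(-α|k|²) = (π/α)^(N/2)` for `α > 0`. -/
noncomputable def dimIntegral (N : ℝ) (f : ℝ → ℝ → ℝ) : ℝ :=
  -(Real.pi ^ ((N - 1) / 2) / Real.Gamma ((N + 1) / 2)) *
    ∫ z in (Set.univ : Set ℝ) ×ˢ Set.Ioi (0 : ℝ),
      z.2 ^ ((N - 1) / 2) * deriv (fun u : ℝ => f z.1 u) z.2

/-- The integrand `1 / (p'² + q'⁴) · 1 / (|p' + p|² + |q' + q|⁴)` in axial coordinates: `x` and `y`
are the components of `p'` and `q'` along `p` and `q`, while `u` and `v` are the squared lengths of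
the transverse parts of `p'` and `q'`. Here `p, q ≥ 0` are the lengths of the external vectors. -/
noncomputable def feynmanIntegrand (p q x u y v : ℝ) : ℝ :=
  1 / ((x ^ 2 + u) + (y ^ 2 + v) ^ 2) *
    (1 / (((x + p) ^ 2 + u) + ((y + q) ^ 2 + v) ^ 2))

/-- The Feynman integral
`I_{D,m}(p,q) = ∫ d^m q' / (2π)^m ∫ d^D p' / (2π)^D
  1 / (p'² + q'⁴) · 1 / (|p' + p|² + |q' + q|⁴)`
in real dimensions `D` and `m`, as a function of the lengths `p, q ≥ 0`. -/
noncomputable def feynmanI (D m p q : ℝ) : ℝ :=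
  1 / (2 * Real.pi) ^ m * dimIntegral m (fun y v =>
    1 / (2 * Real.pi) ^ D * dimIntegral D (fun x u => feynmanIntegrand p q x u y v))

/-- The coefficient `E_D = 4 (16π)^((D-3)/2) / Γ(3/2 - D/2)`. -/
noncomputable def lowerBoundaryCoeff (D : ℝ) : ℝ :=
  4 * (16 * Real.pi) ^ ((D - 3) / 2) / Real.Gamma (3 / 2 - D / 2)

open MeasureTheory Set Real
open scoped ENNReal

/-! The pole is infrared: it comes from the zero of one propagator, and the two propagators
contribute equally. The `p'` integral is evaluated exactly with a Feynman parameter `β`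
(`dimIntegral_feynman`), leaving `∫ Δ ^ (D/2 - 2) dβ` with `Δ = β(1-β)p² + (1-β)w² + βB`, where `w =
y² + v` and `B = ((y+q)² + v)²`. Differentiating in `v` produces two terms exchanged by `β ↦ 1 - β`,
`y ↦ -q - y`, so the amplitude is a smooth prefactor times the integral of `v ^ (3/2 - D + ε)`
against one half (`feynmanI_eq`).

Put `S = p² + q⁴` and `s = 3 - D/2`. Near `β = 0`, `w = 0` one has `Δ ≈ w² + βS`, so that half
behaves like `w ^ (3 - 2s) / ((s - 1) S)`. Integration by parts in `β` makes this exact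
(`integral_loopRemainder`). Integrating `v ^ (3/2 - D + ε) (y² + v) ^ (D - 3)` over `y` gives a
multiple of `v ^ (ε - 1)`, hence exactly a multiple of `1/ε` on `0 < v ≤ 1` (`integral_strip_main`).

Everything else is bounded uniformly in `ε`: the remainder for `v ≤ 1` because `S - Δ'` vanishes at
the singular point (`abs_loopRemainder_le`), and the region `v > 1` by decay (`loop_integrand_le`).
The prefactor is differentiable at `ε = 0`, so only its value there meets the pole; the duplication
formula turns that value into `E_D` (`loopPrefactor_zero_mul`). -/

/-! ### Gamma, Gaussian and beta integrals, for nonnegative functions. -/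

theorem lintegral_Ioi_rpow_mul_exp_neg {κ A : ℝ} (hκ : 0 < κ) (hA : 0 < A) :
    ∫⁻ t in Ioi (0 : ℝ), ENNReal.ofReal (t ^ (κ - 1) * exp (-(A * t))) =
      ENNReal.ofReal (Gamma κ * A ^ (-κ)) := by
  have h := integral_rpow_mul_exp_neg_mul_Ioi hκ hA
  have hpos : 0 < (1 / A) ^ κ * Gamma κ := mul_pos (by positivity) (Gamma_pos_of_pos hκ)
  rw [← ofReal_integral_eq_lintegral_ofReal, h, one_div, inv_rpow hA.le, rpow_neg hA.le, mul_comm]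
  · exact .of_integral_ne_zero (by rw [h]; exact hpos.ne')
  · filter_upwards [ae_restrict_mem measurableSet_Ioi] with t ht
    have : (0 : ℝ) < t := ht
    simp only [Pi.zero_apply]
    positivity

/-- Tonelli's theorem applied to `Γ(κ) h⁻ᵏ = ∫ t ^ (κ - 1) exp (-h t) dt`. -/
theorem Gamma_mul_lintegral_rpow_neg {X : Type*} [MeasurableSpace X] (μ : Measure X) [SFinite μ]
    {κ : ℝ} (hκ : 0 < κ) {g h : X → ℝ} (hg : Measurable g) (hh : Measurable h)
    (hpos : ∀ᵐ x ∂μ, 0 ≤ g x ∧ 0 < h x) :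
    ENNReal.ofReal (Gamma κ) * ∫⁻ x, ENNReal.ofReal (g x * h x ^ (-κ)) ∂μ =
      ∫⁻ t in Ioi (0 : ℝ), ENNReal.ofReal (t ^ (κ - 1)) *
        ∫⁻ x, ENNReal.ofReal (g x * exp (-(h x * t))) ∂μ := by
  have hΓ := Gamma_pos_of_pos hκ
  calc _ = ∫⁻ x, (∫⁻ t in Ioi (0 : ℝ), ENNReal.ofReal (g x * (t ^ (κ - 1) * exp (-(h x * t))))) ∂μ := by
        rw [← lintegral_const_mul _ (by fun_prop)]
        refine lintegral_congr_ae ?_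
        filter_upwards [hpos] with x hx
        simp_rw [ENNReal.ofReal_mul hx.1]
        rw [lintegral_const_mul _ (by fun_prop), lintegral_Ioi_rpow_mul_exp_neg hκ hx.2,
          ENNReal.ofReal_mul hΓ.le]
        ring
    _ = ∫⁻ t in Ioi (0 : ℝ), ∫⁻ x, ENNReal.ofReal (g x * (t ^ (κ - 1) * exp (-(h x * t)))) ∂μ :=
        lintegral_lintegral_swap (by fun_prop)
    _ = _ := by
        refine setLIntegral_congr_fun measurableSet_Ioi fun t ht => ?_
        have ht' : (0 : ℝ) < t := ht
        rw [← lintegral_const_mul _ (by fun_prop)]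
        refine lintegral_congr fun x => ?_
        rw [← ENNReal.ofReal_mul (by positivity)]
        ring_nf

theorem lintegral_exp_neg_mul_sq {b : ℝ} (hb : 0 < b) :
    ∫⁻ x : ℝ, ENNReal.ofReal (exp (-b * x ^ 2)) = ENNReal.ofReal (√π * b ^ (-(1 / 2) : ℝ)) := by
  rw [← ofReal_integral_eq_lintegral_ofReal (integrable_exp_neg_mul_sq hb)
    (.of_forall fun _ => (exp_pos _).le), integral_gaussian, sqrt_div pi_pos.le, rpow_neg hb.le,
    ← sqrt_eq_rpow, div_eq_mul_inv]

theorem lintegral_sq_add_rpow_neg {κ v : ℝ} (hκ : 1 / 2 < κ) (hv : 0 < v) :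
    ∫⁻ x : ℝ, ENNReal.ofReal ((x ^ 2 + v) ^ (-κ)) =
      ENNReal.ofReal (√π * Gamma (κ - 1 / 2) / Gamma κ * v ^ (1 / 2 - κ)) := by
  have hκ0 : 0 < κ := by linarith
  have hΓ := Gamma_pos_of_pos hκ0
  have key := Gamma_mul_lintegral_rpow_neg (volume : Measure ℝ) hκ0 (g := fun _ => 1)
    (h := fun x => x ^ 2 + v) (by fun_prop) (by fun_prop)
    (.of_forall fun x => ⟨zero_le_one, by positivity⟩)
  simp only [one_mul] at key
  have h2 : ∀ t ∈ Ioi (0 : ℝ), ENNReal.ofReal (t ^ (κ - 1)) *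
      ∫⁻ x : ℝ, ENNReal.ofReal (exp (-((x ^ 2 + v) * t))) =
      ENNReal.ofReal √π * ENNReal.ofReal (t ^ ((κ - 1 / 2) - 1) * exp (-(v * t))) := by
    intro t ht
    have ht' : (0 : ℝ) < t := ht
    have h3 : ∀ x : ℝ, ENNReal.ofReal (exp (-((x ^ 2 + v) * t))) =
        ENNReal.ofReal (exp (-(v * t))) * ENNReal.ofReal (exp (-t * x ^ 2)) := fun x => by
      rw [← ENNReal.ofReal_mul (exp_pos _).le, ← exp_add]; ring_nf
    simp_rw [h3]
    rw [lintegral_const_mul _ (by fun_prop), lintegral_exp_neg_mul_sq ht',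
      ← ENNReal.ofReal_mul (exp_pos _).le, ← ENNReal.ofReal_mul (by positivity),
      ← ENNReal.ofReal_mul (by positivity),
      show κ - 1 / 2 - 1 = (κ - 1) + (-(1 / 2)) by ring, rpow_add ht']
    ring_nf
  rw [setLIntegral_congr_fun measurableSet_Ioi h2, lintegral_const_mul _ (by fun_prop),
    lintegral_Ioi_rpow_mul_exp_neg (by linarith) hv, ← ENNReal.ofReal_mul (by positivity)] at key
  rw [← ENNReal.mul_right_inj (a := ENNReal.ofReal (Gamma κ)) (by simpa using hΓ)
    ENNReal.ofReal_ne_top, key, ← ENNReal.ofReal_mul hΓ.le, neg_sub]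
  congr 1
  field_simp

theorem lintegral_Ioi_rpow_mul_add_rpow_neg {b κ A : ℝ} (hb : -1 < b) (hκ : b + 1 < κ)
    (hA : 0 < A) :
    ∫⁻ u in Ioi (0 : ℝ), ENNReal.ofReal (u ^ b * (u + A) ^ (-κ)) =
      ENNReal.ofReal (Gamma (b + 1) * Gamma (κ - b - 1) / Gamma κ * A ^ (b + 1 - κ)) := by
  have hκ0 : 0 < κ := by linarith
  have hΓ := Gamma_pos_of_pos hκ0
  have hΓb := Gamma_pos_of_pos (show 0 < b + 1 by linarith)
  have key := Gamma_mul_lintegral_rpow_neg (volume.restrict (Ioi (0 : ℝ))) hκ0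
    (g := fun u => u ^ b) (h := fun u => u + A) (by fun_prop) (by fun_prop) (by
      filter_upwards [ae_restrict_mem measurableSet_Ioi] with u hu
      have : (0 : ℝ) < u := hu
      constructor <;> positivity)
  have h2 : ∀ t ∈ Ioi (0 : ℝ), ENNReal.ofReal (t ^ (κ - 1)) *
      ∫⁻ u in Ioi (0 : ℝ), ENNReal.ofReal (u ^ b * exp (-((u + A) * t))) =
      ENNReal.ofReal (Gamma (b + 1)) *
        ENNReal.ofReal (t ^ ((κ - b - 1) - 1) * exp (-(A * t))) := by
    intro t ht
    have ht' : (0 : ℝ) < t := ht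
    have h3 : ∀ u : ℝ, ENNReal.ofReal (u ^ b * exp (-((u + A) * t))) =
        ENNReal.ofReal (exp (-(A * t))) *
          ENNReal.ofReal (u ^ ((b + 1) - 1) * exp (-(t * u))) := fun u => by
      rw [← ENNReal.ofReal_mul (exp_pos _).le, show -((u + A) * t) = -(A * t) + -(t * u) by ring,
        exp_add]
      ring_nf
    simp_rw [h3]
    rw [lintegral_const_mul _ (by fun_prop), lintegral_Ioi_rpow_mul_exp_neg (by linarith) ht',
      ← ENNReal.ofReal_mul (exp_pos _).le, ← ENNReal.ofReal_mul (by positivity),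
      ← ENNReal.ofReal_mul (by positivity),
      show κ - b - 1 - 1 = (κ - 1) + (-(b + 1)) by ring, rpow_add ht']
    ring_nf
  rw [setLIntegral_congr_fun measurableSet_Ioi h2, lintegral_const_mul _ (by fun_prop),
    lintegral_Ioi_rpow_mul_exp_neg (by linarith) hA, ← ENNReal.ofReal_mul (by positivity)] at key
  rw [← ENNReal.mul_right_inj (a := ENNReal.ofReal (Gamma κ)) (by simpa using hΓ)
    ENNReal.ofReal_ne_top, key, ← ENNReal.ofReal_mul hΓ.le,
    show b + 1 - κ = -(κ - b - 1) by ring]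
  congr 1
  field_simp

/-! ### Feynman parameters and the `p'` integral. -/

/-- The denominator of the Feynman parameter integral. -/
noncomputable def feynmanDenom (p A B β : ℝ) : ℝ :=
  β * (1 - β) * p ^ 2 + (1 - β) * A + β * B

theorem feynmanDenom_pos {p A B β : ℝ} (hA : 0 < A) (hB : 0 < B) (hβ : β ∈ Icc (0 : ℝ) 1) :
    0 < feynmanDenom p A B β := by
  unfold feynmanDenom
  obtain ⟨h0, h1⟩ := hβ
  have : 0 ≤ β * (1 - β) * p ^ 2 := by
    have := sub_nonneg.2 h1
    positivity
  rcases h0.eq_or_lt with rfl | h0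
  · simpa using hA
  · have := mul_nonneg (sub_nonneg.2 h1) hA.le
    have := mul_pos h0 hB
    linarith

/-- With `L = (1-β)a + βb`, this primitive is `(a⁻² - L⁻²) / (b - a)` with the factor `b - a`
cancelled, so `a = b` needs no separate case. -/
theorem hasDerivAt_feynman_parameter {a b β : ℝ} (ha : 0 < a) (h : 0 < (1 - β) * a + β * b) :
    HasDerivAt (fun β => β * ((1 - β) * a + β * b + a) / (a ^ 2 * ((1 - β) * a + β * b) ^ 2))
      (2 * ((1 - β) * a + β * b) ^ (-3 : ℝ)) β := by
  have hL : HasDerivAt (fun β => (1 - β) * a + β * b) (b - a) β :=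
    ((((hasDerivAt_id' β).const_sub 1).mul_const a).fun_add
      ((hasDerivAt_id' β).mul_const b)).congr_deriv (by ring)
  refine (((hasDerivAt_id' β).fun_mul (hL.add_const a)).fun_div ((hL.fun_pow 2).const_mul (a ^ 2))
    (by positivity)).congr_deriv ?_
  rw [show (-3 : ℝ) = ((-3 : ℤ) : ℝ) by norm_num, rpow_intCast, zpow_neg]
  norm_cast
  field_simp
  ring

theorem convex_pos {a b β : ℝ} (ha : 0 < a) (hb : 0 < b) (hβ : β ∈ Icc (0 : ℝ) 1) :
    0 < (1 - β) * a + β * b := by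
  simpa [feynmanDenom] using feynmanDenom_pos (p := 0) ha hb hβ

theorem lintegral_feynman_parameter {a b : ℝ} (ha : 0 < a) (hb : 0 < b) :
    ∫⁻ β in Ioc (0 : ℝ) 1, ENNReal.ofReal (2 * ((1 - β) * a + β * b) ^ (-3 : ℝ)) =
      ENNReal.ofReal ((a + b) / (a ^ 2 * b ^ 2)) := by
  have hcont : ContinuousOn (fun β : ℝ => 2 * ((1 - β) * a + β * b) ^ (-3 : ℝ)) (Icc 0 1) := by
    refine continuousOn_const.mul (ContinuousOn.rpow_const (by fun_prop) fun β hβ => ?_)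
    exact .inl (convex_pos ha hb hβ).ne'
  rw [← ofReal_integral_eq_lintegral_ofReal
    ((hcont.integrableOn_Icc).mono_set Ioc_subset_Icc_self),
    ← intervalIntegral.integral_of_le zero_le_one,
    intervalIntegral.integral_eq_sub_of_hasDerivAt
      (f := fun β => β * ((1 - β) * a + β * b + a) / (a ^ 2 * ((1 - β) * a + β * b) ^ 2))
      (fun β hβ => hasDerivAt_feynman_parameter ha (convex_pos ha hb ?_))
      (hcont.intervalIntegrable_of_Icc zero_le_one)]
  · congr 1
    simp
    ring
  · rwa [uIcc_of_le zero_le_one] at hβ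
  · filter_upwards [ae_restrict_mem measurableSet_Ioc] with β hβ
    have := convex_pos ha hb (Ioc_subset_Icc_self hβ)
    simp only [Pi.zero_apply]
    positivity

theorem lintegral_lintegral_shift_rpow {b c Δ : ℝ} (hb : -1 < b) (hb2 : b < 3 / 2)
    (hΔ : 0 < Δ) :
    ∫⁻ z in (univ : Set ℝ) ×ˢ Ioi (0 : ℝ),
      ENNReal.ofReal (z.2 ^ b * (2 * ((z.1 + c) ^ 2 + z.2 + Δ) ^ (-3 : ℝ))) =
    ENNReal.ofReal (√π * Gamma (b + 1) * Gamma (3 / 2 - b) * Δ ^ (b - 3 / 2)) := by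
  rw [Measure.volume_eq_prod, setLIntegral_prod_symm _ (by fun_prop), Measure.restrict_univ]
  have h1 : ∀ u ∈ Ioi (0 : ℝ), ∫⁻ x : ℝ,
      ENNReal.ofReal (u ^ b * (2 * ((x + c) ^ 2 + u + Δ) ^ (-3 : ℝ))) =
      ENNReal.ofReal (√π * Gamma (5 / 2)) * ENNReal.ofReal (u ^ b * (u + Δ) ^ (-(5 / 2) : ℝ)) := by
    intro u hu
    have hu' : (0 : ℝ) < u := hu
    rw [lintegral_add_right_eq_self
      (fun x => ENNReal.ofReal (u ^ b * (2 * (x ^ 2 + u + Δ) ^ (-3 : ℝ)))) c]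
    have h2 : ∀ x : ℝ, ENNReal.ofReal (u ^ b * (2 * (x ^ 2 + u + Δ) ^ (-3 : ℝ))) =
        ENNReal.ofReal (2 * u ^ b) * ENNReal.ofReal ((x ^ 2 + (u + Δ)) ^ (-3 : ℝ)) := fun x => by
      rw [← ENNReal.ofReal_mul (by positivity), add_assoc]
      ring_nf
    simp_rw [h2]
    have hG5 := Gamma_pos_of_pos (show (0 : ℝ) < 5 / 2 by norm_num)
    rw [lintegral_const_mul _ (by fun_prop), lintegral_sq_add_rpow_neg (by norm_num) (by positivity),
      ← ENNReal.ofReal_mul (by positivity), ← ENNReal.ofReal_mul (by positivity)]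
    have hG : Gamma 3 = 2 := by
      rw [show (3 : ℝ) = (2 : ℕ) + 1 by norm_num, Gamma_nat_eq_factorial]; norm_num
    rw [hG]
    norm_num
    ring_nf
  have hG5 := Gamma_pos_of_pos (show (0 : ℝ) < 5 / 2 by norm_num)
  rw [setLIntegral_congr_fun measurableSet_Ioi h1, lintegral_const_mul _ (by fun_prop),
    lintegral_Ioi_rpow_mul_add_rpow_neg hb (by linarith) hΔ, ← ENNReal.ofReal_mul (by positivity),
    show 5 / 2 - b - 1 = 3 / 2 - b by ring, show b + 1 - 5 / 2 = b - 3 / 2 by ring]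
  congr 1
  field_simp

theorem deriv_inv_mul_inv {x p u A B : ℝ} (ha : 0 < x ^ 2 + u + A)
    (hb : 0 < (x + p) ^ 2 + u + B) :
    deriv (fun u => 1 / (x ^ 2 + u + A) * (1 / ((x + p) ^ 2 + u + B))) u =
      -(((x ^ 2 + u + A) + ((x + p) ^ 2 + u + B)) /
        ((x ^ 2 + u + A) ^ 2 * ((x + p) ^ 2 + u + B) ^ 2)) := by
  have h1 : HasDerivAt (fun u => x ^ 2 + u + A) 1 u :=
    ((hasDerivAt_id u).const_add _).add_const _
  have h2 : HasDerivAt (fun u => (x + p) ^ 2 + u + B) 1 u :=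
    ((hasDerivAt_id u).const_add _).add_const _
  simp_rw [one_div]
  rw [((h1.fun_inv ha.ne').fun_mul (h2.fun_inv hb.ne')).deriv]
  field_simp
  ring

/-- The `u`-derivative of `1/(ab)` is `-(a + b)/(a²b²)`, which is minus a Feynman parameter integral
of `2((1-β)a + βb)⁻³`. Completing the square turns the base into `(x + βp)² + u + Δ`; by Tonelli the
`x` and `u` integrals can then be done at fixed `β`. -/
theorem dimIntegral_feynman {D p A B : ℝ} (hD0 : 0 < D) (hD4 : D < 4) (hA : 0 < A) (hB : 0 < B) :
    dimIntegral D (fun x u => 1 / (x ^ 2 + u + A) * (1 / ((x + p) ^ 2 + u + B))) =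
      π ^ (D / 2) * Gamma (2 - D / 2) * ∫ β in (0 : ℝ)..1, feynmanDenom p A B β ^ (D / 2 - 2) := by
  have hms : MeasurableSet ((univ : Set ℝ) ×ˢ Ioi (0 : ℝ)) := MeasurableSet.univ.prod measurableSet_Ioi
  have hG1 := Gamma_pos_of_pos (show 0 < (D + 1) / 2 by linarith)
  have hG2 := Gamma_pos_of_pos (show 0 < 2 - D / 2 by linarith)
  have hpos : ∀ z ∈ (univ : Set ℝ) ×ˢ Ioi (0 : ℝ),
      0 < z.2 ∧ 0 < z.1 ^ 2 + z.2 + A ∧ 0 < (z.1 + p) ^ 2 + z.2 + B := by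
    intro z hz
    have : 0 < z.2 := hz.2
    refine ⟨this, ?_, ?_⟩ <;> positivity
  have hlin : ∫⁻ z in (univ : Set ℝ) ×ˢ Ioi (0 : ℝ), ENNReal.ofReal (z.2 ^ ((D - 1) / 2) *
      (((z.1 ^ 2 + z.2 + A) + ((z.1 + p) ^ 2 + z.2 + B)) /
        ((z.1 ^ 2 + z.2 + A) ^ 2 * ((z.1 + p) ^ 2 + z.2 + B) ^ 2))) =
      ENNReal.ofReal (√π * Gamma ((D + 1) / 2) * Gamma (2 - D / 2)) *
        ∫⁻ β in Ioc (0 : ℝ) 1, ENNReal.ofReal (feynmanDenom p A B β ^ (D / 2 - 2)) := by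
    calc _ = ∫⁻ z in (univ : Set ℝ) ×ˢ Ioi (0 : ℝ), ∫⁻ β in Ioc (0 : ℝ) 1,
            ENNReal.ofReal (z.2 ^ ((D - 1) / 2) * (2 * ((1 - β) * (z.1 ^ 2 + z.2 + A) +
              β * ((z.1 + p) ^ 2 + z.2 + B)) ^ (-3 : ℝ))) := by
          refine setLIntegral_congr_fun hms fun z hz => ?_
          obtain ⟨hz0, hza, hzb⟩ := hpos z hz
          rw [ENNReal.ofReal_mul (by positivity), ← lintegral_feynman_parameter hza hzb,
            ← lintegral_const_mul _ (by fun_prop)]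
          simp_rw [ENNReal.ofReal_mul (rpow_nonneg hz0.le _)]
      _ = ∫⁻ β in Ioc (0 : ℝ) 1, ∫⁻ z in (univ : Set ℝ) ×ˢ Ioi (0 : ℝ),
            ENNReal.ofReal (z.2 ^ ((D - 1) / 2) * (2 * ((1 - β) * (z.1 ^ 2 + z.2 + A) +
              β * ((z.1 + p) ^ 2 + z.2 + B)) ^ (-3 : ℝ))) :=
          lintegral_lintegral_swap (by fun_prop)
      _ = _ := by
          rw [← lintegral_const_mul _ (by unfold feynmanDenom; fun_prop)]
          refine setLIntegral_congr_fun measurableSet_Ioc fun β hβ => ?_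
          have hΔ := feynmanDenom_pos (p := p) hA hB (Ioc_subset_Icc_self hβ)
          have := lintegral_lintegral_shift_rpow (b := (D - 1) / 2) (c := β * p)
            (by linarith) (by linarith) hΔ
          rw [show (D - 1) / 2 + 1 = (D + 1) / 2 by ring,
            show 3 / 2 - (D - 1) / 2 = 2 - D / 2 by ring,
            show (D - 1) / 2 - 3 / 2 = D / 2 - 2 by ring] at this
          rw [← ENNReal.ofReal_mul (by positivity), ← this]
          refine lintegral_congr fun z => ?_
          unfold feynmanDenom
          ring_nf
  have hcont : ContinuousOn (fun β : ℝ => feynmanDenom p A B β ^ (D / 2 - 2)) (Icc 0 1) := by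
    refine ContinuousOn.rpow_const (by unfold feynmanDenom; fun_prop) fun β hβ => ?_
    exact .inl (feynmanDenom_pos hA hB hβ).ne'
  rw [← ofReal_integral_eq_lintegral_ofReal
    ((hcont.integrableOn_Icc).mono_set Ioc_subset_Icc_self),
    ← intervalIntegral.integral_of_le zero_le_one, ← ENNReal.ofReal_mul (by positivity)] at hlin
  swap
  · filter_upwards [ae_restrict_mem measurableSet_Ioc] with β hβ
    exact rpow_nonneg (feynmanDenom_pos hA hB (Ioc_subset_Icc_self hβ)).le _
  have hint0 : 0 ≤ ∫ β in (0 : ℝ)..1, feynmanDenom p A B β ^ (D / 2 - 2) :=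
    intervalIntegral.integral_nonneg zero_le_one fun β hβ =>
      rpow_nonneg (feynmanDenom_pos hA hB hβ).le _
  have hval := congrArg ENNReal.toReal hlin
  rw [ENNReal.toReal_ofReal (by positivity), ← integral_eq_lintegral_of_nonneg_ae] at hval
  · unfold dimIntegral
    have : ∀ z ∈ (univ : Set ℝ) ×ˢ Ioi (0 : ℝ), z.2 ^ ((D - 1) / 2) *
        deriv (fun u => 1 / (z.1 ^ 2 + u + A) * (1 / ((z.1 + p) ^ 2 + u + B))) z.2 =
        -(z.2 ^ ((D - 1) / 2) * (((z.1 ^ 2 + z.2 + A) + ((z.1 + p) ^ 2 + z.2 + B)) /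
        ((z.1 ^ 2 + z.2 + A) ^ 2 * ((z.1 + p) ^ 2 + z.2 + B) ^ 2))) := fun z hz => by
      rw [deriv_inv_mul_inv (hpos z hz).2.1 (hpos z hz).2.2, mul_neg]
    rw [setIntegral_congr_fun hms this, integral_neg, hval, neg_mul_neg, sqrt_eq_rpow,
      show D / 2 = (D - 1) / 2 + 1 / 2 by ring, rpow_add pi_pos,
      show 2 - ((D - 1) / 2 + 1 / 2) = 2 - D / 2 by ring,
      show (D - 1) / 2 + 1 / 2 - 2 = D / 2 - 2 by ring]
    field_simp
  · filter_upwards [ae_restrict_mem hms] with z hz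
    obtain ⟨hz0, hza, hzb⟩ := hpos z hz
    simp only [Pi.zero_apply]
    positivity
  · exact (by fun_prop : Measurable _).aestronglyMeasurable

/-! ### Lower bounds for the loop denominator. -/

/-- The Feynman parameter denominator of the one-loop integral after the `p'` integration. -/
noncomputable def loopDenom (p q y v β : ℝ) : ℝ :=
  feynmanDenom p ((y ^ 2 + v) ^ 2) (((y + q) ^ 2 + v) ^ 2) β

theorem loopDenom_pos {p q y v β : ℝ} (hv : 0 < v) (hβ : β ∈ Icc (0 : ℝ) 1) :
    0 < loopDenom p q y v β :=
  feynmanDenom_pos (by positivity) (by positivity) hβ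

/-- Convexity of the square: the weighted mean of `y² + v` and `(y+q)² + v` is `(y+βq)² + v +
β(1-β)q²`, and the excess is a variance plus the `p²` term. -/
theorem sq_le_loopDenom {p q y v β : ℝ} (hv : 0 < v) (hβ : β ∈ Icc (0 : ℝ) 1) :
    ((y + β * q) ^ 2 + v) ^ 2 ≤ loopDenom p q y v β := by
  obtain ⟨h0, h1⟩ := hβ
  have hγ : 0 ≤ β * (1 - β) := mul_nonneg h0 (sub_nonneg.2 h1)
  have e : loopDenom p q y v β - ((y + β * q) ^ 2 + v + β * (1 - β) * q ^ 2) ^ 2 =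
      β * (1 - β) * (p ^ 2 + (2 * y * q + q ^ 2) ^ 2) := by
    unfold loopDenom feynmanDenom; ring
  have h2 : ((y + β * q) ^ 2 + v) ^ 2 ≤ ((y + β * q) ^ 2 + v + β * (1 - β) * q ^ 2) ^ 2 := by
    have : 0 ≤ β * (1 - β) * q ^ 2 := by positivity
    exact pow_le_pow_left₀ (by positivity) (by linarith) 2
  have : 0 ≤ β * (1 - β) * (p ^ 2 + (2 * y * q + q ^ 2) ^ 2) := by positivity
  linarith

/-- Either `|y| ≥ q/2` or `|y + q| ≥ q/2`, so one of the two quartic terms is at least `(q/2)⁴`;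
this is the origin of `16`. -/
theorem mul_le_loopDenom {p q y v β : ℝ} (hq : 0 ≤ q) (hv : 0 < v) (hβ : β ∈ Icc (0 : ℝ) 1) :
    β * (1 - β) * ((p ^ 2 + q ^ 4) / 16) ≤ loopDenom p q y v β := by
  obtain ⟨h0, h1⟩ := hβ
  have h1' : 0 ≤ 1 - β := sub_nonneg.2 h1
  have hγ : 0 ≤ β * (1 - β) := mul_nonneg h0 h1'
  have key : ∀ x : ℝ, q ^ 2 / 4 ≤ x ^ 2 → q ^ 4 / 16 ≤ (x ^ 2 + v) ^ 2 := fun x hx => by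
    calc q ^ 4 / 16 = (q ^ 2 / 4) ^ 2 := by ring
      _ ≤ (x ^ 2 + v) ^ 2 := pow_le_pow_left₀ (by positivity) (by linarith) 2
  have hp : β * (1 - β) * (p ^ 2 / 16) ≤ β * (1 - β) * p ^ 2 := by
    gcongr; linarith [sq_nonneg p]
  have hA : 0 ≤ (1 - β) * (y ^ 2 + v) ^ 2 := by positivity
  have hB : 0 ≤ β * ((y + q) ^ 2 + v) ^ 2 := by positivity
  have hq : β * (1 - β) * (q ^ 4 / 16) ≤ (1 - β) * (y ^ 2 + v) ^ 2 + β * ((y + q) ^ 2 + v) ^ 2 := by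
    rcases le_total (q ^ 2 / 4) (y ^ 2) with h | h
    · have : β * (1 - β) * (q ^ 4 / 16) ≤ (1 - β) * (y ^ 2 + v) ^ 2 := by
        calc β * (1 - β) * (q ^ 4 / 16) ≤ 1 * (1 - β) * (y ^ 2 + v) ^ 2 := by
              gcongr; exact key y h
          _ = _ := by ring
      linarith
    · have h' : q ^ 2 / 4 ≤ (y + q) ^ 2 := by
        have := (abs_le_of_sq_le_sq' (show y ^ 2 ≤ (q / 2) ^ 2 by linarith) (by positivity)).1
        nlinarith
      have : β * (1 - β) * (q ^ 4 / 16) ≤ β * ((y + q) ^ 2 + v) ^ 2 := by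
        calc β * (1 - β) * (q ^ 4 / 16) ≤ β * 1 * ((y + q) ^ 2 + v) ^ 2 := by
              gcongr
              · linarith
              · exact key _ h'
          _ = _ := by ring
      linarith
  unfold loopDenom feynmanDenom
  linarith

theorem one_sub_mul_sq_le_loopDenom {p q y v β : ℝ} (hβ : β ∈ Icc (0 : ℝ) 1) :
    (1 - β) * (y ^ 2 + v) ^ 2 ≤ loopDenom p q y v β := by
  obtain ⟨h0, h1⟩ := hβ
  have h1' : 0 ≤ 1 - β := sub_nonneg.2 h1
  have : 0 ≤ β * (1 - β) * p ^ 2 := by positivity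
  have : 0 ≤ β * ((y + q) ^ 2 + v) ^ 2 := by positivity
  unfold loopDenom feynmanDenom
  linarith

theorem mul_sq_le_loopDenom {p q y v β : ℝ} (hβ : β ∈ Icc (0 : ℝ) 1) :
    β * (1 - β) * p ^ 2 ≤ loopDenom p q y v β := by
  obtain ⟨h0, h1⟩ := hβ
  have h1' : 0 ≤ 1 - β := sub_nonneg.2 h1
  have : 0 ≤ (1 - β) * (y ^ 2 + v) ^ 2 := by positivity
  have : 0 ≤ β * ((y + q) ^ 2 + v) ^ 2 := by positivity
  unfold loopDenom feynmanDenom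
  linarith

theorem continuous_loopDenom (p q y v : ℝ) : Continuous (loopDenom p q y v) := by
  unfold loopDenom feynmanDenom
  fun_prop

theorem continuousOn_loopDenom_rpow {p q y v : ℝ} (hv : 0 < v) (t : ℝ) :
    ContinuousOn (fun β => loopDenom p q y v β ^ t) (Icc 0 1) :=
  (continuous_loopDenom p q y v).continuousOn.rpow_const
    fun _ hβ => .inl (loopDenom_pos hv hβ).ne'

/-- Interpolates between the two preceding kinds of lower bound: the `τ` part gives decay in `y` and
`v`, the `σ` part costs only a power of `β(1-β)`. -/
theorem loopDenom_rpow_neg_le {p q y v β τ σ : ℝ} (hq : 0 ≤ q) (hS : 0 < p ^ 2 + q ^ 4) (hv : 0 < v)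
    (hβ : β ∈ Ioo (0 : ℝ) 1) (hτ : 0 ≤ τ) (hσ : 0 ≤ σ) :
    loopDenom p q y v β ^ (-(τ + σ)) ≤
      ((p ^ 2 + q ^ 4) / 16) ^ (-σ) *
        (((y + β * q) ^ 2 + v) ^ (-(2 * τ)) * (β * (1 - β)) ^ (-σ)) := by
  have hβ' := Ioo_subset_Icc_self hβ
  have hγ : 0 < β * (1 - β) := mul_pos hβ.1 (sub_pos.2 hβ.2)
  have hΔ := loopDenom_pos (p := p) (q := q) (y := y) hv hβ'
  have hR : 0 < (y + β * q) ^ 2 + v := by positivity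
  have h1 : loopDenom p q y v β ^ (-τ) ≤ ((y + β * q) ^ 2 + v) ^ (-(2 * τ)) := by
    calc _ ≤ (((y + β * q) ^ 2 + v) ^ 2) ^ (-τ) :=
          rpow_le_rpow_of_nonpos (by positivity) (sq_le_loopDenom hv hβ') (by linarith)
      _ = _ := by rw [← rpow_natCast, ← rpow_mul hR.le]; norm_num
  have h2 : loopDenom p q y v β ^ (-σ) ≤
      (β * (1 - β)) ^ (-σ) * ((p ^ 2 + q ^ 4) / 16) ^ (-σ) := by
    rw [← mul_rpow hγ.le (by positivity)]
    exact rpow_le_rpow_of_nonpos (by positivity) (mul_le_loopDenom hq hv hβ') (by linarith)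
  calc _ = loopDenom p q y v β ^ (-τ) * loopDenom p q y v β ^ (-σ) := by
        rw [← rpow_add hΔ]; ring_nf
    _ ≤ ((y + β * q) ^ 2 + v) ^ (-(2 * τ)) *
        ((β * (1 - β)) ^ (-σ) * ((p ^ 2 + q ^ 4) / 16) ^ (-σ)) := by gcongr
    _ = _ := by ring

/-! ### Separating the singular term by parts in `β`. -/

/-- The derivative of `loopDenom` in the Feynman parameter. -/
noncomputable def loopDenomDeriv (p q y v β : ℝ) : ℝ :=
  (1 - 2 * β) * p ^ 2 - (y ^ 2 + v) ^ 2 + ((y + q) ^ 2 + v) ^ 2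

theorem hasDerivAt_loopDenom (p q y v β : ℝ) :
    HasDerivAt (loopDenom p q y v) (loopDenomDeriv p q y v β) β := by
  have h1 := ((hasDerivAt_id' β).fun_mul ((hasDerivAt_id' β).const_sub 1)).mul_const (p ^ 2)
  have h2 := ((hasDerivAt_id' β).const_sub 1).mul_const ((y ^ 2 + v) ^ 2)
  have h3 := (hasDerivAt_id' β).mul_const (((y + q) ^ 2 + v) ^ 2)
  refine ((h1.fun_add h2).fun_add h3).congr_deriv ?_
  unfold loopDenomDeriv
  ring

/-- The integrand is the derivative of `-(1-β) Δ ^ (1-s) / (s-1)`. The weight `1 - β` kills the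
boundary term at `β = 1`, and `Δ = (y² + v)²` at `β = 0`. -/
theorem integral_loopDenom_by_parts {p q y v s : ℝ} (hs : 1 < s) (hv : 0 < v) :
    ∫ β in (0 : ℝ)..1, ((1 - β) * loopDenom p q y v β ^ (-s) * loopDenomDeriv p q y v β +
      loopDenom p q y v β ^ (1 - s) / (s - 1)) = (y ^ 2 + v) ^ (2 - 2 * s) / (s - 1) := by
  have hs' : s - 1 ≠ 0 := by linarith
  have hw : 0 < y ^ 2 + v := by positivity
  rw [intervalIntegral.integral_eq_sub_of_hasDerivAt
    (f := fun β => -((1 - β) * loopDenom p q y v β ^ (1 - s)) / (s - 1))]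
  · have : loopDenom p q y v 0 = (y ^ 2 + v) ^ 2 := by simp [loopDenom, feynmanDenom]
    rw [this, ← rpow_natCast, ← rpow_mul hw.le]
    norm_num
    rw [show 2 * (1 - s) = 2 - 2 * s by ring]
    ring
  · intro β hβ
    rw [uIcc_of_le zero_le_one] at hβ
    have hΔ := loopDenom_pos (p := p) (q := q) (y := y) hv hβ
    refine ((((hasDerivAt_id' β).const_sub 1).fun_mul ((hasDerivAt_loopDenom p q y v β).rpow_const
      (p := 1 - s) (.inl hΔ.ne'))).fun_neg.div_const _).congr_deriv ?_
    rw [show 1 - s - 1 = -s by ring]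
    field_simp
    ring
  · refine ContinuousOn.intervalIntegrable_of_Icc zero_le_one ?_
    have h1 := continuousOn_loopDenom_rpow (p := p) (q := q) (y := y) hv (-s)
    have h2 := continuousOn_loopDenom_rpow (p := p) (q := q) (y := y) hv (1 - s)
    unfold loopDenomDeriv
    fun_prop

/-- The part of the integrand that stays integrable at the lower boundary dimension. -/
noncomputable def loopRemainder (s p q y v β : ℝ) : ℝ :=
  (y ^ 2 + v) * ((1 - β) * loopDenom p q y v β ^ (-s) *
    (p ^ 2 + q ^ 4 - loopDenomDeriv p q y v β) - loopDenom p q y v β ^ (1 - s) / (s - 1))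

theorem integral_loopRemainder {p q y v s : ℝ} (hs : 1 < s) (hv : 0 < v) :
    ∫ β in (0 : ℝ)..1, loopRemainder s p q y v β =
      (p ^ 2 + q ^ 4) * (∫ β in (0 : ℝ)..1,
        (y ^ 2 + v) * ((1 - β) * loopDenom p q y v β ^ (-s))) -
        (y ^ 2 + v) ^ (3 - 2 * s) / (s - 1) := by
  have h1 := continuousOn_loopDenom_rpow (p := p) (q := q) (y := y) hv (-s)
  have h2 := continuousOn_loopDenom_rpow (p := p) (q := q) (y := y) hv (1 - s)
  have hw : 0 < y ^ 2 + v := by positivity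
  rw [show 3 - 2 * s = 1 + (2 - 2 * s) by ring, rpow_add hw, rpow_one, mul_div_assoc,
    ← integral_loopDenom_by_parts (p := p) (q := q) hs hv, ← intervalIntegral.integral_const_mul,
    ← intervalIntegral.integral_const_mul, ← intervalIntegral.integral_sub]
  · refine intervalIntegral.integral_congr fun β _ => ?_
    simp only [loopRemainder]
    ring
  · refine ContinuousOn.intervalIntegrable_of_Icc zero_le_one ?_
    fun_prop
  · refine ContinuousOn.intervalIntegrable_of_Icc zero_le_one ?_
    unfold loopDenomDeriv
    fun_prop

/-! ### Pointwise bounds for the remainder and the integrand. -/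

/-- At `β = y = v = 0` the slope equals `p² + q⁴`; this quantifies the gain nearby. With `r = √(y² +
v) ≥ |y|` the error is a polynomial in `r`, whose middle power is absorbed by `r² ≤ r + r³`. -/
theorem abs_sub_loopDenomDeriv_le {p q y v β : ℝ} (hq : 0 ≤ q) (hv : 0 < v) (hβ : 0 ≤ β) :
    |p ^ 2 + q ^ 4 - loopDenomDeriv p q y v β| ≤
      2 * β * p ^ 2 + (4 * q ^ 3 + 6 * q ^ 2 + 4 * q) *
        ((y ^ 2 + v) ^ (1 / 2 : ℝ) + (y ^ 2 + v) ^ (3 / 2 : ℝ)) := by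
  have hw : 0 < y ^ 2 + v := by positivity
  set r := √(y ^ 2 + v) with hr
  have hr0 : 0 < r := sqrt_pos.2 hw
  have hrr : r ^ 2 = y ^ 2 + v := sq_sqrt hw.le
  have hy : |y| ≤ r := abs_le_sqrt (by linarith)
  have e1 : (y ^ 2 + v) ^ (1 / 2 : ℝ) = r := (sqrt_eq_rpow _).symm
  have e2 : (y ^ 2 + v) ^ (3 / 2 : ℝ) = r ^ 3 := by
    rw [hr, sqrt_eq_rpow, ← rpow_natCast _ 3, ← rpow_mul hw.le]; norm_num
  rw [e1, e2]
  have e3 : p ^ 2 + q ^ 4 - loopDenomDeriv p q y v β =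
      2 * β * p ^ 2 - (4 * q ^ 2 * (y * y) + 4 * r ^ 2 * q * y + 2 * r ^ 2 * q ^ 2
        + 4 * y * q ^ 3) := by
    unfold loopDenomDeriv
    rw [hrr]
    ring
  rw [e3]
  have hyy : |y * y| ≤ r ^ 2 := by rw [abs_mul, sq]; gcongr
  have hr2 : r ^ 2 ≤ r + r ^ 3 := by nlinarith [sq_nonneg (r - 1), mul_nonneg hr0.le (sq_nonneg (r-1))]
  calc _ ≤ |2 * β * p ^ 2| + (|4 * q ^ 2 * (y * y)| + |4 * r ^ 2 * q * y| + |2 * r ^ 2 * q ^ 2|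
        + |4 * y * q ^ 3|) :=
        (abs_sub _ _).trans (by
          gcongr
          exact (abs_add_le _ _).trans (by gcongr; exact abs_add_three _ _ _))
    _ = 2 * β * p ^ 2 + (4 * q ^ 2 * |y * y| + 4 * r ^ 2 * q * |y| + 2 * r ^ 2 * q ^ 2
        + 4 * |y| * q ^ 3) := by
        rw [abs_of_nonneg (show 0 ≤ 2 * β * p ^ 2 by positivity), abs_mul (4 * q ^ 2),
          abs_mul (4 * r ^ 2 * q), abs_of_nonneg (show 0 ≤ 2 * r ^ 2 * q ^ 2 by positivity),
          abs_mul (4 * y), abs_mul 4 y, abs_of_nonneg (show 0 ≤ 4 * q ^ 2 by positivity),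
          abs_of_nonneg (show 0 ≤ 4 * r ^ 2 * q by positivity),
          abs_of_nonneg (show 0 ≤ q ^ 3 by positivity), abs_of_pos (four_pos (α := ℝ))]
    _ ≤ 2 * β * p ^ 2 + (4 * q ^ 2 * r ^ 2 + 4 * r ^ 2 * q * r + 2 * r ^ 2 * q ^ 2
        + 4 * r * q ^ 3) := by gcongr
    _ = 2 * β * p ^ 2 + (4 * q ^ 3 * r + 6 * q ^ 2 * r ^ 2 + 4 * q * r ^ 3) := by ring
    _ ≤ 2 * β * p ^ 2 + (4 * q ^ 3 * (r + r ^ 3) + 6 * q ^ 2 * (r + r ^ 3)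
        + 4 * q * (r + r ^ 3)) := by
        gcongr
        · linarith [pow_pos hr0 3]
        · linarith
    _ = _ := by ring

theorem base_le_rpow {p q y v β : ℝ} (hv : 0 < v) (hβ : β ∈ Ioo (0 : ℝ) 1) {t : ℝ} (ht : 0 ≤ t) :
    (y ^ 2 + v) ^ (2 * t) ≤ loopDenom p q y v β ^ t * (1 - β) ^ (-t) := by
  have hw : 0 < y ^ 2 + v := by positivity
  have he : 0 < 1 - β := sub_pos.2 hβ.2
  calc (y ^ 2 + v) ^ (2 * t) = ((1 - β) * (y ^ 2 + v) ^ 2) ^ t * (1 - β) ^ (-t) := by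
        rw [mul_rpow he.le (by positivity), ← rpow_natCast (y ^ 2 + v) 2, ← rpow_mul hw.le, mul_right_comm,
          ← rpow_add he]
        norm_num
    _ ≤ _ := by
        gcongr
        exact one_sub_mul_sq_le_loopDenom (Ioo_subset_Icc_self hβ)

/-- Trades powers of `y² + v` for powers of `Δ` through `(1-β)(y² + v)² ≤ Δ`; the factor `1 - β` in
front pays for part of the loss at `β = 1`. -/
theorem one_sub_mul_base_rpow_le {p q y v β : ℝ} (hv : 0 < v) (hβ : β ∈ Ioo (0 : ℝ) 1) {t σ : ℝ}
    (ht : 0 ≤ t) :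
    (1 - β) * ((y ^ 2 + v) ^ (2 * t) * loopDenom p q y v β ^ (-σ)) ≤
      (1 - β) ^ (1 - t) * loopDenom p q y v β ^ (-(σ - t)) := by
  have hΔ := loopDenom_pos (p := p) (q := q) (y := y) hv (Ioo_subset_Icc_self hβ)
  have he : 0 < 1 - β := sub_pos.2 hβ.2
  calc _ ≤ (1 - β) * ((loopDenom p q y v β ^ t * (1 - β) ^ (-t)) * loopDenom p q y v β ^ (-σ)) := by
        gcongr
        exact base_le_rpow hv hβ ht
    _ = _ := by
        rw [show 1 - t = 1 + -t by ring, rpow_add he, rpow_one,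
          show -(σ - t) = t + -σ by ring, rpow_add hΔ]
        ring

theorem abs_loopRemainder_le {D p q : ℝ} (hD2 : D < 2) (hq : 0 ≤ q)
    (hS : 0 < p ^ 2 + q ^ 4) :
    ∃ C : ℝ, 0 ≤ C ∧ ∀ y v β : ℝ, 0 < v → β ∈ Ioo (0 : ℝ) 1 →
      |loopRemainder (3 - D / 2) p q y v β| ≤
        C * (((y + β * q) ^ 2 + v) ^ (-(11 / 4 - D)) * (β * (1 - β)) ^ (-(7 / 8) : ℝ)) := by
  set S := p ^ 2 + q ^ 4 with hSdef
  set Q := 4 * q ^ 3 + 6 * q ^ 2 + 4 * q with hQ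
  have hQ0 : 0 ≤ Q := by positivity
  refine ⟨3 * (S / 16) ^ (-(1 / 8) : ℝ) + Q * (S / 16) ^ (-(7 / 8) : ℝ) +
    Q * (S / 16) ^ (-(3 / 8) : ℝ), by positivity, fun y v β hv hβ => ?_⟩
  have hΔ := loopDenom_pos (p := p) (q := q) (y := y) hv (Ioo_subset_Icc_self hβ)
  have he : 0 < 1 - β := sub_pos.2 hβ.2
  have he1 : 1 - β ≤ 1 := by linarith [hβ.1]
  have hγ : 0 < β * (1 - β) := mul_pos hβ.1 he
  have hγe : β * (1 - β) ≤ 1 - β := by nlinarith [hβ.2]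
  have hγ1 : β * (1 - β) ≤ 1 := hγe.trans he1
  have hw : 0 < y ^ 2 + v := by positivity
  have hR : 0 < (y + β * q) ^ 2 + v := by positivity
  -- With `τ = α - D/2`, integrability in `v` near `0` needs `α < 3/2`, while `hB` leaves `σ = 9/4 -
  -- α`, which must stay below `1` for integrability in `β`. The choice `α = 11/8` is the midpoint
  -- of `(5/4, 3/2)` and yields the exponent `7/8`.
  have hbound : ∀ σ a : ℝ, 0 ≤ σ → 0 ≤ a → σ + a ≤ 7 / 8 →
      (1 - β) ^ (-a) * loopDenom p q y v β ^ (-(11 / 8 - D / 2 + σ)) ≤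
      (S / 16) ^ (-σ) * (((y + β * q) ^ 2 + v) ^ (-(11 / 4 - D)) *
        (β * (1 - β)) ^ (-(7 / 8) : ℝ)) := by
    intro σ a hσ ha hσa
    have h1 := loopDenom_rpow_neg_le (y := y) (τ := 11 / 8 - D / 2) hq hS hv hβ (by linarith) hσ
    rw [← hSdef, show 2 * (11 / 8 - D / 2) = 11 / 4 - D by ring] at h1
    have h2 : (1 - β) ^ (-a) ≤ (β * (1 - β)) ^ (-a) :=
      rpow_le_rpow_of_nonpos hγ hγe (by linarith)
    have h3 : (β * (1 - β)) ^ (-(a + σ)) ≤ (β * (1 - β)) ^ (-(7 / 8) : ℝ) :=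
      rpow_le_rpow_of_exponent_ge hγ hγ1 (by linarith)
    calc _ ≤ (β * (1 - β)) ^ (-a) * ((S / 16) ^ (-σ) *
          (((y + β * q) ^ 2 + v) ^ (-(11 / 4 - D)) * (β * (1 - β)) ^ (-σ))) := by gcongr
      _ = (S / 16) ^ (-σ) * (((y + β * q) ^ 2 + v) ^ (-(11 / 4 - D)) *
          (β * (1 - β)) ^ (-(a + σ))) := by
          rw [neg_add, rpow_add hγ]; ring
      _ ≤ _ := by gcongr
  set M := ((y + β * q) ^ 2 + v) ^ (-(11 / 4 - D)) * (β * (1 - β)) ^ (-(7 / 8) : ℝ) with hM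
  have hA : (y ^ 2 + v) * loopDenom p q y v β ^ (-(2 - D / 2)) ≤ (S / 16) ^ (-(1 / 8) : ℝ) * M := by
    refine le_trans ?_ (hbound (1 / 8) (1 / 2) (by norm_num) (by norm_num) (by norm_num))
    have h := one_sub_mul_base_rpow_le (p := p) (q := q) (y := y) (σ := 2 - D / 2) hv hβ
      (show (0 : ℝ) ≤ 1 / 2 by norm_num)
    rw [show (1 : ℝ) - 1 / 2 = 1 + -(1 / 2) by norm_num, rpow_add he, rpow_one, mul_assoc,
      mul_le_mul_iff_right₀ he, show (2 : ℝ) * (1 / 2) = 1 by norm_num, rpow_one] at h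
    convert h using 3
    ring
  have hB : (1 - β) * ((y ^ 2 + v) * loopDenom p q y v β ^ (-(3 - D / 2)) *
      (y ^ 2 + v) ^ (1 / 2 : ℝ)) ≤ (S / 16) ^ (-(7 / 8) : ℝ) * M := by
    refine le_trans ?_ (hbound (7 / 8) 0 (by norm_num) (by norm_num) (by norm_num))
    have h := one_sub_mul_base_rpow_le (p := p) (q := q) (y := y) (σ := 3 - D / 2) hv hβ
      (show (0 : ℝ) ≤ 3 / 4 by norm_num)
    have e : (1 - β) ^ (1 - 3 / 4 : ℝ) ≤ 1 := rpow_le_one he.le he1 (by norm_num)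
    rw [neg_zero, rpow_zero, one_mul]
    calc _ = _ := ?_
      _ ≤ _ := h
      _ ≤ 1 * loopDenom p q y v β ^ (-(3 - D / 2 - 3 / 4)) := by gcongr
      _ = _ := by rw [one_mul]; ring_nf
    rw [show (2 : ℝ) * (3 / 4) = 1 + 1 / 2 by norm_num, rpow_add hw, rpow_one]
    ring
  have hC : (1 - β) * ((y ^ 2 + v) * loopDenom p q y v β ^ (-(3 - D / 2)) *
      (y ^ 2 + v) ^ (3 / 2 : ℝ)) ≤ (S / 16) ^ (-(3 / 8) : ℝ) * M := by
    refine le_trans ?_ (hbound (3 / 8) (1 / 4) (by norm_num) (by norm_num) (by norm_num))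
    have h := one_sub_mul_base_rpow_le (p := p) (q := q) (y := y) (σ := 3 - D / 2) hv hβ
      (show (0 : ℝ) ≤ 5 / 4 by norm_num)
    calc _ = _ := ?_
      _ ≤ _ := h
      _ = _ := by norm_num; left; ring_nf
    rw [show (2 : ℝ) * (5 / 4) = 1 + 3 / 2 by norm_num, rpow_add hw, rpow_one]
    ring
  -- The `p²` error is absorbed by one power of `Δ`, reducing it to twice the term of `hA`; together
  -- with the subtracted term this gives the constant `3`.
  have hP : (1 - β) * ((y ^ 2 + v) * loopDenom p q y v β ^ (-(3 - D / 2))) * (2 * β * p ^ 2) ≤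
      2 * ((y ^ 2 + v) * loopDenom p q y v β ^ (-(2 - D / 2))) := by
    have h := mul_sq_le_loopDenom (p := p) (q := q) (y := y) (v := v) (Ioo_subset_Icc_self hβ)
    calc _ = 2 * ((y ^ 2 + v) * (loopDenom p q y v β ^ (-(3 - D / 2)) * (β * (1 - β) * p ^ 2))) := by
          ring
      _ ≤ 2 * ((y ^ 2 + v) * (loopDenom p q y v β ^ (-(3 - D / 2)) * loopDenom p q y v β)) := by
          gcongr
      _ = _ := by
          rw [← rpow_add_one hΔ.ne']
          ring_nf
  have hd := abs_sub_loopDenomDeriv_le (p := p) (q := q) (y := y) hq hv hβ.1.le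
  rw [← hSdef, ← hQ] at hd
  have hs1 : 1 ≤ 3 - D / 2 - 1 := by linarith
  unfold loopRemainder
  rw [abs_mul, abs_of_pos hw, show 1 - (3 - D / 2) = -(2 - D / 2) by ring]
  have hX : 0 ≤ loopDenom p q y v β ^ (-(2 - D / 2)) := rpow_nonneg hΔ.le _
  calc _ ≤ (y ^ 2 + v) * (|(1 - β) * loopDenom p q y v β ^ (-(3 - D / 2)) *
          (S - loopDenomDeriv p q y v β)| +
          |loopDenom p q y v β ^ (-(2 - D / 2)) / (3 - D / 2 - 1)|) := by
        gcongr; exact abs_sub _ _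
    _ ≤ (y ^ 2 + v) * ((1 - β) * loopDenom p q y v β ^ (-(3 - D / 2)) *
          (2 * β * p ^ 2 + Q * ((y ^ 2 + v) ^ (1 / 2 : ℝ) + (y ^ 2 + v) ^ (3 / 2 : ℝ))) +
          loopDenom p q y v β ^ (-(2 - D / 2))) := by
        rw [abs_mul, abs_of_nonneg (show 0 ≤ (1 - β) * loopDenom p q y v β ^ (-(3 - D / 2)) by
          positivity), abs_of_nonneg (div_nonneg hX (by linarith))]
        have := div_le_self hX hs1
        gcongr
    _ = (1 - β) * ((y ^ 2 + v) * loopDenom p q y v β ^ (-(3 - D / 2))) * (2 * β * p ^ 2) +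
        Q * ((1 - β) * ((y ^ 2 + v) * loopDenom p q y v β ^ (-(3 - D / 2)) *
          (y ^ 2 + v) ^ (1 / 2 : ℝ))) +
        Q * ((1 - β) * ((y ^ 2 + v) * loopDenom p q y v β ^ (-(3 - D / 2)) *
          (y ^ 2 + v) ^ (3 / 2 : ℝ))) +
        (y ^ 2 + v) * loopDenom p q y v β ^ (-(2 - D / 2)) := by ring
    _ ≤ 2 * ((S / 16) ^ (-(1 / 8) : ℝ) * M) + Q * ((S / 16) ^ (-(7 / 8) : ℝ) * M) +
        Q * ((S / 16) ^ (-(3 / 8) : ℝ) * M) + (S / 16) ^ (-(1 / 8) : ℝ) * M := by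
        have := hP.trans (mul_le_mul_of_nonneg_left hA zero_le_two)
        gcongr ?_ + Q * ?_ + Q * ?_ + ?_
    _ = _ := by ring

theorem loop_integrand_le {D p q y v β : ℝ} (hD2 : D < 2) (hv : 0 < v) (hβ : β ∈ Ioo (0 : ℝ) 1) :
    (y ^ 2 + v) * ((1 - β) * loopDenom p q y v β ^ (-(3 - D / 2))) ≤
      ((y + β * q) ^ 2 + v) ^ (-(5 - D)) := by
  have he : 0 < 1 - β := sub_pos.2 hβ.2
  have he1 : 1 - β ≤ 1 := by linarith [hβ.1]
  have hR : 0 < (y + β * q) ^ 2 + v := by positivity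
  have h := one_sub_mul_base_rpow_le (p := p) (q := q) (y := y) (σ := 3 - D / 2) hv hβ
    (show (0 : ℝ) ≤ 1 / 2 by norm_num)
  have e : (1 - β) ^ (1 - 1 / 2 : ℝ) ≤ 1 := rpow_le_one he.le he1 (by norm_num)
  have hΔ := loopDenom_pos (p := p) (q := q) (y := y) hv (Ioo_subset_Icc_self hβ)
  calc _ = _ := ?_
    _ ≤ _ := h
    _ ≤ 1 * (((y + β * q) ^ 2 + v) ^ 2) ^ (-(3 - D / 2 - 1 / 2)) := by
        gcongr ?_ * ?_
        exact rpow_le_rpow_of_nonpos (by positivity)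
          (sq_le_loopDenom hv (Ioo_subset_Icc_self hβ)) (by linarith)
    _ = _ := by
        rw [one_mul, ← rpow_natCast, ← rpow_mul hR.le]
        congr 1
        push_cast
        ring
  rw [show (2 : ℝ) * (1 / 2) = 1 by norm_num, rpow_one]
  ring

/-! ### Integrals over strips in `v`. -/

/-- At fixed `β`, translating `y` removes the shift `βq`, so the three integrals factor. It serves
the pole and both error bounds. -/
theorem lintegral_strip {b κ q : ℝ} (hκ : 1 / 2 < κ) {T : Set ℝ} (hT : MeasurableSet T)
    (hT0 : T ⊆ Ioi 0) {h : ℝ → ℝ} (hh : Measurable h) :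
    ∫⁻ z in (univ : Set ℝ) ×ˢ T, ∫⁻ β in Ioo (0 : ℝ) 1,
      ENNReal.ofReal (z.2 ^ b * ((z.1 + β * q) ^ 2 + z.2) ^ (-κ)) * ENNReal.ofReal (h β) =
    ENNReal.ofReal (√π * Gamma (κ - 1 / 2) / Gamma κ) *
      (∫⁻ β in Ioo (0 : ℝ) 1, ENNReal.ofReal (h β)) *
        ∫⁻ v in T, ENNReal.ofReal (v ^ (b + 1 / 2 - κ)) := by
  have hG1 := Gamma_pos_of_pos (show 0 < κ by linarith)
  have hG2 := Gamma_pos_of_pos (show 0 < κ - 1 / 2 by linarith)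
  rw [lintegral_lintegral_swap (by fun_prop), mul_right_comm,
    ← lintegral_const_mul _ (by fun_prop)]
  refine lintegral_congr fun β => ?_
  rw [lintegral_mul_const _ (by fun_prop)]
  congr 1
  rw [Measure.volume_eq_prod, setLIntegral_prod_symm _ (by fun_prop), Measure.restrict_univ,
    ← lintegral_const_mul _ (by fun_prop)]
  refine setLIntegral_congr_fun hT fun v hv => ?_
  have hv' : 0 < v := hT0 hv
  rw [lintegral_add_right_eq_self
    (fun y => ENNReal.ofReal (v ^ b * (y ^ 2 + v) ^ (-κ))) (β * q)]
  simp_rw [ENNReal.ofReal_mul (rpow_nonneg hv'.le b)]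
  rw [lintegral_const_mul _ (by fun_prop), lintegral_sq_add_rpow_neg hκ hv',
    ← ENNReal.ofReal_mul (by positivity), ← ENNReal.ofReal_mul (by positivity), add_sub_assoc,
    rpow_add hv']
  ring_nf

theorem lintegral_Ioc_zero_one_rpow {t : ℝ} (ht : -1 < t) :
    ∫⁻ v in Ioc (0 : ℝ) 1, ENNReal.ofReal (v ^ t) = ENNReal.ofReal (1 / (t + 1)) := by
  rw [← ofReal_integral_eq_lintegral_ofReal
      (intervalIntegral.intervalIntegrable_rpow' ht (a := 0) (b := 1)).1,
    ← intervalIntegral.integral_of_le zero_le_one, integral_rpow (.inl ht)]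
  · rw [one_rpow, zero_rpow (by linarith), sub_zero]
  · filter_upwards [ae_restrict_mem measurableSet_Ioc] with v hv
    exact rpow_nonneg hv.1.le _

theorem lintegral_Ioi_one_rpow_lt_top {t : ℝ} (ht : t < -1) :
    ∫⁻ v in Ioi (1 : ℝ), ENNReal.ofReal (v ^ t) < ∞ :=
  (integrableOn_Ioi_rpow_of_lt ht one_pos).lintegral_lt_top

theorem lintegral_mul_one_sub_rpow_lt_top :
    ∫⁻ β in Ioo (0 : ℝ) 1, ENNReal.ofReal ((β * (1 - β)) ^ (-(7 / 8) : ℝ)) < ∞ := by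
  have h1 : IntervalIntegrable (fun x : ℝ => x ^ (-(7 / 8) : ℝ)) volume 0 1 :=
    intervalIntegral.intervalIntegrable_rpow' (by norm_num)
  have h2 : IntervalIntegrable (fun x : ℝ => (1 - x) ^ (-(7 / 8) : ℝ)) volume 0 1 := by
    have := (h1.comp_sub_left 1).symm
    simpa using this
  have h3 := ((h1.add h2).const_mul ((1 / 2 : ℝ) ^ (-(7 / 8) : ℝ))).1.mono_set
    (Ioo_subset_Ioc_self)
  refine lt_of_le_of_lt (setLIntegral_mono' measurableSet_Ioo fun β hβ => ?_) h3.lintegral_lt_top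
  have hβ1 : 0 < 1 - β := sub_pos.2 hβ.2
  have hβ0 := hβ.1
  refine ENNReal.ofReal_le_ofReal ?_
  rw [mul_rpow hβ0.le hβ1.le]
  have p1 : 0 < β ^ (-(7 / 8) : ℝ) := by positivity
  have p2 : 0 < (1 - β) ^ (-(7 / 8) : ℝ) := by positivity
  have p3 : 0 < (1 / 2 : ℝ) ^ (-(7 / 8) : ℝ) := by positivity
  rcases le_total β (1 / 2) with h | h
  · have : (1 - β) ^ (-(7 / 8) : ℝ) ≤ (1 / 2 : ℝ) ^ (-(7 / 8) : ℝ) :=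
      rpow_le_rpow_of_nonpos (by norm_num) (by linarith) (by norm_num)
    nlinarith [mul_pos p2 p3]
  · have : β ^ (-(7 / 8) : ℝ) ≤ (1 / 2 : ℝ) ^ (-(7 / 8) : ℝ) :=
      rpow_le_rpow_of_nonpos (by norm_num) (by linarith) (by norm_num)
    nlinarith [mul_pos p1 p3]

theorem integrable_and_abs_integral_le {X : Type*} [MeasurableSpace X] {μ : Measure X} {f : X → ℝ}
    (hf : AEStronglyMeasurable f μ) {g : X → ℝ≥0∞} (hg : ∫⁻ x, g x ∂μ < ∞)
    (hfg : ∀ᵐ x ∂μ, ‖f x‖ₑ ≤ g x) :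
    Integrable f μ ∧ |∫ x, f x ∂μ| ≤ (∫⁻ x, g x ∂μ).toReal := by
  have h := lintegral_mono_ae hfg
  refine ⟨⟨hf, h.trans_lt hg⟩, ?_⟩
  rw [← Real.norm_eq_abs, ← toReal_enorm]
  exact ENNReal.toReal_mono hg.ne ((enorm_integral_le_lintegral_enorm f).trans h)

/-! ### The pole and the uniform error bounds. -/

/-- One of the two halves, exchanged by `β ↦ 1 - β`, of the Feynman parameter integral. -/
noncomputable def loopHalf (D p q y v : ℝ) : ℝ :=
  ∫ β in (0 : ℝ)..1, (y ^ 2 + v) * ((1 - β) * loopDenom p q y v β ^ (-(3 - D / 2)))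

theorem loopHalf_eq (D p q y v : ℝ) : loopHalf D p q y v =
    ∫ β in Ioo (0 : ℝ) 1, (y ^ 2 + v) * ((1 - β) * loopDenom p q y v β ^ (-(3 - D / 2))) := by
  rw [loopHalf, intervalIntegral.integral_of_le zero_le_one, integral_Ioc_eq_integral_Ioo]

theorem stronglyMeasurable_loopHalf (D p q : ℝ) :
    StronglyMeasurable (fun z : ℝ × ℝ => loopHalf D p q z.1 z.2) := by
  simp_rw [loopHalf_eq]
  refine StronglyMeasurable.integral_prod_right (f := fun (z : ℝ × ℝ) (β : ℝ) =>
    (z.1 ^ 2 + z.2) * ((1 - β) * loopDenom p q z.1 z.2 β ^ (-(3 - D / 2)))) ?_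
  unfold loopDenom feynmanDenom Function.uncurry
  exact (by fun_prop : Measurable _).stronglyMeasurable

theorem integral_strip_main {D ε : ℝ} (hD2 : D < 2) (hε : 0 < ε) :
    IntegrableOn (fun z : ℝ × ℝ => z.2 ^ (3 / 2 - D + ε) * (z.1 ^ 2 + z.2) ^ (D - 3))
      (univ ×ˢ Ioc 0 1) ∧
    ∫ z in (univ : Set ℝ) ×ˢ Ioc (0 : ℝ) 1, z.2 ^ (3 / 2 - D + ε) * (z.1 ^ 2 + z.2) ^ (D - 3) =
      √π * Gamma (5 / 2 - D) / Gamma (3 - D) / ε := by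
  have hG1 := Gamma_pos_of_pos (show 0 < 5 / 2 - D by linarith)
  have hG2 := Gamma_pos_of_pos (show 0 < 3 - D by linarith)
  have h := lintegral_strip (b := 3 / 2 - D + ε) (κ := 3 - D) (q := 0) (by linarith)
    (measurableSet_Ioc (a := (0 : ℝ)) (b := 1)) (fun _ h => h.1) (h := fun _ => 1) (by fun_prop)
  simp only [mul_zero, add_zero, ENNReal.ofReal_one, mul_one, lintegral_const,
    Measure.restrict_apply MeasurableSet.univ, univ_inter, Real.volume_Ioo, sub_zero, neg_sub] at h
  rw [lintegral_Ioc_zero_one_rpow (by linarith), show 3 - D - 1 / 2 = 5 / 2 - D by ring,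
    ← ENNReal.ofReal_mul (by positivity),
    show 3 / 2 - D + ε + 1 / 2 - (3 - D) + 1 = ε by ring, mul_one_div] at h
  have hnn : 0 ≤ᵐ[volume.restrict ((univ : Set ℝ) ×ˢ Ioc (0 : ℝ) 1)]
      fun z : ℝ × ℝ => z.2 ^ (3 / 2 - D + ε) * (z.1 ^ 2 + z.2) ^ (D - 3) := by
    filter_upwards [ae_restrict_mem (MeasurableSet.univ.prod measurableSet_Ioc)] with z hz
    have : 0 < z.2 := hz.2.1
    change 0 ≤ z.2 ^ (3 / 2 - D + ε) * (z.1 ^ 2 + z.2) ^ (D - 3)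
    positivity
  have hm : AEStronglyMeasurable
      (fun z : ℝ × ℝ => z.2 ^ (3 / 2 - D + ε) * (z.1 ^ 2 + z.2) ^ (D - 3))
      (volume.restrict ((univ : Set ℝ) ×ˢ Ioc (0 : ℝ) 1)) :=
    (by fun_prop : Measurable _).aestronglyMeasurable
  refine ⟨(lintegral_ofReal_ne_top_iff_integrable hm hnn).1 (by rw [h]; exact ENNReal.ofReal_ne_top),
    ?_⟩
  rw [integral_eq_lintegral_of_nonneg_ae hnn hm, h, ENNReal.toReal_ofReal (by positivity)]

theorem exists_bound_loopRemainder {D p q : ℝ} (hD2 : D < 2) (hq : 0 ≤ q)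
    (hS : 0 < p ^ 2 + q ^ 4) :
    ∃ C : ℝ, ∀ ε : ℝ, 0 < ε →
      IntegrableOn (fun z : ℝ × ℝ => z.2 ^ (3 / 2 - D + ε) *
        ∫ β in (0 : ℝ)..1, loopRemainder (3 - D / 2) p q z.1 z.2 β) (univ ×ˢ Ioc 0 1) ∧
      |∫ z in (univ : Set ℝ) ×ˢ Ioc (0 : ℝ) 1, z.2 ^ (3 / 2 - D + ε) *
        ∫ β in (0 : ℝ)..1, loopRemainder (3 - D / 2) p q z.1 z.2 β| ≤ C := by
  obtain ⟨C, hC0, hC⟩ := abs_loopRemainder_le hD2 hq hS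
  -- The majorant is taken at `ε = 0`, since `v ^ ε ≤ 1` on this strip; the `y` integral leaves `v ^
  -- (-3/4)`.
  have hJ := lintegral_strip (b := 3 / 2 - D) (κ := 11 / 4 - D) (q := q) (by linarith)
    (measurableSet_Ioc (a := (0 : ℝ)) (b := 1)) (fun _ h => h.1)
    (h := fun β => C * (β * (1 - β)) ^ (-(7 / 8) : ℝ)) (by fun_prop)
  have hJ' := hJ.trans_lt (ENNReal.mul_lt_top (ENNReal.mul_lt_top ENNReal.ofReal_lt_top (by
      simp_rw [ENNReal.ofReal_mul hC0]
      rw [lintegral_const_mul _ (by fun_prop)]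
      exact ENNReal.mul_lt_top ENNReal.ofReal_lt_top lintegral_mul_one_sub_rpow_lt_top)) (by
      rw [lintegral_Ioc_zero_one_rpow (by linarith)]
      exact ENNReal.ofReal_lt_top))
  refine ⟨_, fun ε hε => integrable_and_abs_integral_le ?_ hJ' ?_⟩
  · have hms : StronglyMeasurable (fun z : ℝ × ℝ =>
        ∫ β in Ioo (0 : ℝ) 1, loopRemainder (3 - D / 2) p q z.1 z.2 β) := by
      refine StronglyMeasurable.integral_prod_right (f := fun (z : ℝ × ℝ) (β : ℝ) =>
        loopRemainder (3 - D / 2) p q z.1 z.2 β) ?_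
      unfold loopRemainder loopDenomDeriv loopDenom feynmanDenom Function.uncurry
      exact (by fun_prop : Measurable _).stronglyMeasurable
    simp_rw [intervalIntegral.integral_of_le (zero_le_one (α := ℝ)), integral_Ioc_eq_integral_Ioo]
    exact ((by fun_prop : Measurable fun z : ℝ × ℝ => z.2 ^ (3 / 2 - D + ε)).stronglyMeasurable.mul
      hms).aestronglyMeasurable
  · filter_upwards [ae_restrict_mem (MeasurableSet.univ.prod measurableSet_Ioc)] with z hz
    have hz0 : 0 < z.2 := hz.2.1
    have hz1 : z.2 ≤ 1 := hz.2.2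
    rw [intervalIntegral.integral_of_le zero_le_one, integral_Ioc_eq_integral_Ioo,
      ← integral_const_mul]
    refine (enorm_integral_le_lintegral_enorm _).trans (setLIntegral_mono' measurableSet_Ioo
      fun β hβ => ?_)
    rw [← ENNReal.ofReal_mul (by positivity), Real.enorm_eq_ofReal_abs, abs_mul,
      abs_of_nonneg (rpow_nonneg hz0.le _)]
    refine ENNReal.ofReal_le_ofReal ?_
    calc _ ≤ z.2 ^ (3 / 2 - D) * (C * (((z.1 + β * q) ^ 2 + z.2) ^ (-(11 / 4 - D)) *
          (β * (1 - β)) ^ (-(7 / 8) : ℝ))) :=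
          mul_le_mul (rpow_le_rpow_of_exponent_ge hz0 hz1 (by linarith)) (hC _ _ _ hz0 hβ)
            (abs_nonneg _) (by positivity)
      _ = _ := by ring

theorem exists_bound_loopHalf_Ioi_one {D : ℝ} (p q : ℝ) (hD2 : D < 2) :
    ∃ C : ℝ, ∀ ε : ℝ, ε ≤ 1 →
      IntegrableOn (fun z : ℝ × ℝ => z.2 ^ (3 / 2 - D + ε) * loopHalf D p q z.1 z.2)
        (univ ×ˢ Ioi 1) ∧
      |∫ z in (univ : Set ℝ) ×ˢ Ioi (1 : ℝ), z.2 ^ (3 / 2 - D + ε) * loopHalf D p q z.1 z.2| ≤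
        C := by
  -- For `v > 1` the worst case is `ε = 1`; the `y` integral leaves `v ^ (-2)`.
  have hJ := lintegral_strip (b := 5 / 2 - D) (κ := 5 - D) (q := q) (by linarith)
    (measurableSet_Ioi (a := (1 : ℝ))) (Ioi_subset_Ioi zero_le_one) (h := fun _ => 1)
    (by fun_prop)
  have hJ' := hJ.trans_lt (ENNReal.mul_lt_top (ENNReal.mul_lt_top ENNReal.ofReal_lt_top
    (by simp)) (lintegral_Ioi_one_rpow_lt_top (by linarith)))
  refine ⟨_, fun ε hε => integrable_and_abs_integral_le ?_ hJ' ?_⟩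
  · exact ((by fun_prop : Measurable fun z : ℝ × ℝ => z.2 ^ (3 / 2 - D + ε)).stronglyMeasurable.mul
      (stronglyMeasurable_loopHalf D p q)).aestronglyMeasurable
  · filter_upwards [ae_restrict_mem (MeasurableSet.univ.prod measurableSet_Ioi)] with z hz
    have hz1 : 1 < z.2 := hz.2
    have hz0 : 0 < z.2 := one_pos.trans hz1
    rw [loopHalf_eq, ← integral_const_mul]
    refine (enorm_integral_le_lintegral_enorm _).trans (setLIntegral_mono' measurableSet_Ioo
      fun β hβ => ?_)
    have hβ1 : 0 < 1 - β := sub_pos.2 hβ.2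
    have hΔ := loopDenom_pos (p := p) (q := q) (y := z.1) hz0 (Ioo_subset_Icc_self hβ)
    rw [ENNReal.ofReal_one, mul_one, Real.enorm_eq_ofReal_abs, abs_of_nonneg (by positivity)]
    refine ENNReal.ofReal_le_ofReal ?_
    exact mul_le_mul (rpow_le_rpow_of_exponent_le hz1.le (by linarith))
      (loop_integrand_le hD2 hz0 hβ) (by positivity) (by positivity)

theorem exists_bound_integral_loopHalf {D p q : ℝ} (hD2 : D < 2) (hq : 0 ≤ q)
    (hS : 0 < p ^ 2 + q ^ 4) :
    ∃ C : ℝ, ∀ ε : ℝ, 0 < ε → ε ≤ 1 →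
      IntegrableOn (fun z : ℝ × ℝ => z.2 ^ (3 / 2 - D + ε) * loopHalf D p q z.1 z.2)
        (univ ×ˢ Ioi 0) ∧
      |(∫ z in (univ : Set ℝ) ×ˢ Ioi (0 : ℝ), z.2 ^ (3 / 2 - D + ε) * loopHalf D p q z.1 z.2) -
        √π * Gamma (5 / 2 - D) / Gamma (3 - D) / (2 - D / 2) / (p ^ 2 + q ^ 4) / ε| ≤ C := by
  obtain ⟨C₁, h₁⟩ := exists_bound_loopRemainder hD2 hq hS
  obtain ⟨C₂, h₂⟩ := exists_bound_loopHalf_Ioi_one p q hD2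
  refine ⟨C₁ / (p ^ 2 + q ^ 4) + C₂, fun ε hε hε1 => ?_⟩
  obtain ⟨i₁, b₁⟩ := h₁ ε hε
  obtain ⟨i₂, b₂⟩ := h₂ ε hε1
  obtain ⟨i₀, e₀⟩ := integral_strip_main hD2 hε
  have hms : MeasurableSet ((univ : Set ℝ) ×ˢ Ioc (0 : ℝ) 1) := MeasurableSet.univ.prod measurableSet_Ioc
  have heq : ∀ z ∈ (univ : Set ℝ) ×ˢ Ioc (0 : ℝ) 1,
      (z.2 ^ (3 / 2 - D + ε) * (z.1 ^ 2 + z.2) ^ (D - 3)) * ((2 - D / 2)⁻¹ * (p ^ 2 + q ^ 4)⁻¹) +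
        (z.2 ^ (3 / 2 - D + ε) * ∫ β in (0 : ℝ)..1, loopRemainder (3 - D / 2) p q z.1 z.2 β) *
          (p ^ 2 + q ^ 4)⁻¹ =
      z.2 ^ (3 / 2 - D + ε) * loopHalf D p q z.1 z.2 := by
    intro z hz
    rw [integral_loopRemainder (by linarith) hz.2.1, show 3 - 2 * (3 - D / 2) = D - 3 by ring,
      show 3 - D / 2 - 1 = 2 - D / 2 by ring]
    change _ = z.2 ^ (3 / 2 - D + ε) * ∫ β in (0 : ℝ)..1, _
    have : 2 - D / 2 ≠ 0 := by linarith
    field_simp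
    ring
  have j₀ := i₀.mul_const ((2 - D / 2)⁻¹ * (p ^ 2 + q ^ 4)⁻¹)
  have j₁ := i₁.mul_const (p ^ 2 + q ^ 4)⁻¹
  have i₃ : IntegrableOn (fun z : ℝ × ℝ => z.2 ^ (3 / 2 - D + ε) * loopHalf D p q z.1 z.2)
      (univ ×ˢ Ioc 0 1) :=
    IntegrableOn.congr_fun (j₀.add j₁) (fun z hz => heq z hz) hms
  have hunion : (univ : Set ℝ) ×ˢ Ioi (0 : ℝ) = univ ×ˢ Ioc 0 1 ∪ univ ×ˢ Ioi 1 := by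
    rw [← prod_union, Ioc_union_Ioi_eq_Ioi zero_le_one]
  have hdisj : Disjoint ((univ : Set ℝ) ×ˢ Ioc (0 : ℝ) 1) (univ ×ˢ Ioi 1) := by
    rw [disjoint_prod]
    exact .inr (Ioc_disjoint_Ioi le_rfl)
  rw [hunion]
  refine ⟨i₃.union i₂, ?_⟩
  rw [setIntegral_union hdisj (MeasurableSet.univ.prod measurableSet_Ioi) i₃ i₂,
    ← setIntegral_congr_fun hms heq, integral_add j₀ j₁, integral_mul_const, integral_mul_const, e₀]
  set X := ∫ z in (univ : Set ℝ) ×ˢ Ioc (0 : ℝ) 1, z.2 ^ (3 / 2 - D + ε) *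
        ∫ β in (0 : ℝ)..1, loopRemainder (3 - D / 2) p q z.1 z.2 β
  set Y := ∫ z in (univ : Set ℝ) ×ˢ Ioi (1 : ℝ), z.2 ^ (3 / 2 - D + ε) * loopHalf D p q z.1 z.2
  calc _ = |X * (p ^ 2 + q ^ 4)⁻¹ + Y| := by congr 1; ring
    _ ≤ |X * (p ^ 2 + q ^ 4)⁻¹| + |Y| := abs_add_le _ _
    _ ≤ _ := by
        rw [abs_mul, abs_of_pos (inv_pos.2 hS), div_eq_mul_inv]
        gcongr

/-! ### The `v` derivative and the reflection symmetry. -/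

open Filter Topology
open scoped Interval

theorem hasDerivAt_loopDenom_base (p q y v β : ℝ) :
    HasDerivAt (fun v => loopDenom p q y v β)
      (2 * ((1 - β) * (y ^ 2 + v) + β * ((y + q) ^ 2 + v))) v := by
  have h1 := (((hasDerivAt_id' v).const_add (y ^ 2)).fun_pow 2).const_mul (1 - β)
  have h2 := (((hasDerivAt_id' v).const_add ((y + q) ^ 2)).fun_pow 2).const_mul β
  refine ((h1.const_add (β * (1 - β) * p ^ 2)).fun_add h2).congr_deriv ?_
  ring

theorem loopHalf_reflect (D p q y v : ℝ) :
    loopHalf D p q (-q - y) v =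
      ∫ β in (0 : ℝ)..1, ((y + q) ^ 2 + v) * (β * loopDenom p q y v β ^ (-(3 - D / 2))) := by
  have h := intervalIntegral.integral_comp_sub_left (a := 0) (b := 1)
    (fun β => ((-q - y) ^ 2 + v) * ((1 - β) * loopDenom p q (-q - y) v β ^ (-(3 - D / 2)))) 1
  rw [sub_self, sub_zero] at h
  rw [loopHalf, ← h]
  refine intervalIntegral.integral_congr fun β _ => ?_
  have e : loopDenom p q (-q - y) v (1 - β) = loopDenom p q y v β := by
    unfold loopDenom feynmanDenom; ring
  simp only [e]
  ring

theorem hasDerivAt_integral_loopDenom (D p q y : ℝ) {v : ℝ} (hv : 0 < v) :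
    HasDerivAt (fun v => ∫ β in (0 : ℝ)..1, loopDenom p q y v β ^ (D / 2 - 2))
      (-(4 - D) * (loopHalf D p q y v + loopHalf D p q (-q - y) v)) v := by
  have hcont : ContinuousOn (fun x : ℝ × ℝ => 2 * ((1 - x.2) * (y ^ 2 + x.1) +
      x.2 * ((y + q) ^ 2 + x.1)) * (D / 2 - 2) * loopDenom p q y x.1 x.2 ^ (D / 2 - 2 - 1))
      (Icc (v / 2) (2 * v) ×ˢ Icc 0 1) := by
    refine ContinuousOn.mul (by fun_prop) (ContinuousOn.rpow_const ?_ fun x hx => ?_)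
    · unfold loopDenom feynmanDenom
      fun_prop
    · exact .inl (loopDenom_pos (by linarith [hx.1.1]) hx.2).ne'
  obtain ⟨C, hC⟩ := (isCompact_Icc.prod isCompact_Icc).exists_bound_of_continuousOn hcont
  have hI : Ι (0 : ℝ) 1 = Ioc 0 1 := uIoc_of_le zero_le_one
  have hmeas : ∀ v t : ℝ, Measurable fun β => loopDenom p q y v β ^ t := fun v t =>
    (continuous_loopDenom p q y v).measurable.pow_const t
  have key := (intervalIntegral.hasDerivAt_integral_of_dominated_loc_of_deriv_le
    (μ := volume) (a := 0) (b := 1)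
    (F := fun v β => loopDenom p q y v β ^ (D / 2 - 2))
    (F' := fun v β => 2 * ((1 - β) * (y ^ 2 + v) + β * ((y + q) ^ 2 + v)) * (D / 2 - 2) *
      loopDenom p q y v β ^ (D / 2 - 2 - 1)) (x₀ := v) (s := Icc (v / 2) (2 * v))
    -- On `[v/2, 2v] × [0, 1]` the denominator stays positive, so compactness supplies a constant
    -- dominating function.
    (bound := fun _ => C) (Icc_mem_nhds (by linarith) (by linarith))
    (.of_forall fun v => (hmeas v _).aestronglyMeasurable)
    ((continuousOn_loopDenom_rpow hv _).intervalIntegrable_of_Icc zero_le_one)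
    (by
      have := hmeas v (D / 2 - 2 - 1)
      exact (by fun_prop : Measurable _).aestronglyMeasurable)
    (.of_forall fun β hβ x hx => hC (x, β) ⟨hx, Ioc_subset_Icc_self (hI ▸ hβ)⟩)
    intervalIntegrable_const
    (.of_forall fun β hβ x hx => (hasDerivAt_loopDenom_base p q y x β).rpow_const
      (.inl (loopDenom_pos (by linarith [hx.1]) (Ioc_subset_Icc_self (hI ▸ hβ))).ne'))).2
  refine key.congr_deriv ?_
  have h1 := continuousOn_loopDenom_rpow (p := p) (q := q) (y := y) hv (-(3 - D / 2))
  rw [loopHalf_reflect, loopHalf, ← intervalIntegral.integral_add,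
    ← intervalIntegral.integral_const_mul]
  · refine intervalIntegral.integral_congr fun β _ => ?_
    simp only [show D / 2 - 2 - 1 = -(3 - D / 2) by ring]
    ring
  · exact ContinuousOn.intervalIntegrable_of_Icc zero_le_one (by fun_prop)
  · exact ContinuousOn.intervalIntegrable_of_Icc zero_le_one (by fun_prop)

theorem deriv_dimIntegral_feynmanIntegrand {D : ℝ} (hD0 : 0 < D) (hD4 : D < 4) (p q y : ℝ) {v : ℝ}
    (hv : 0 < v) :
    deriv (fun v => 1 / (2 * π) ^ D * dimIntegral D (fun x u => feynmanIntegrand p q x u y v)) v =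
      -(1 / (2 * π) ^ D * (π ^ (D / 2) * Gamma (2 - D / 2)) * (4 - D)) *
        (loopHalf D p q y v + loopHalf D p q (-q - y) v) := by
  have heq : (fun v => 1 / (2 * π) ^ D * dimIntegral D (fun x u => feynmanIntegrand p q x u y v))
      =ᶠ[𝓝 v] fun v => 1 / (2 * π) ^ D * (π ^ (D / 2) * Gamma (2 - D / 2)) *
        ∫ β in (0 : ℝ)..1, loopDenom p q y v β ^ (D / 2 - 2) := by
    filter_upwards [Ioi_mem_nhds hv] with v hv
    have hv' : 0 < v := hv
    have := dimIntegral_feynman (p := p) (A := (y ^ 2 + v) ^ 2) (B := ((y + q) ^ 2 + v) ^ 2)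
      hD0 hD4 (by positivity) (by positivity)
    unfold feynmanIntegrand loopDenom
    rw [this]
    ring
  rw [heq.deriv_eq, ((hasDerivAt_integral_loopDenom D p q y hv).const_mul _).deriv]
  ring

theorem integral_loopHalf_reflect {D p q b : ℝ}
    (hi : IntegrableOn (fun z : ℝ × ℝ => z.2 ^ b * loopHalf D p q z.1 z.2) (univ ×ˢ Ioi 0)) :
    ∫ z in (univ : Set ℝ) ×ˢ Ioi (0 : ℝ),
      z.2 ^ b * (loopHalf D p q z.1 z.2 + loopHalf D p q (-q - z.1) z.2) =
    2 * ∫ z in (univ : Set ℝ) ×ˢ Ioi (0 : ℝ), z.2 ^ b * loopHalf D p q z.1 z.2 := by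
  have hμ : (volume : Measure (ℝ × ℝ)).restrict ((univ : Set ℝ) ×ˢ Ioi (0 : ℝ)) =
      (volume : Measure ℝ).prod (volume.restrict (Ioi 0)) := by
    rw [Measure.volume_eq_prod, ← Measure.prod_restrict, Measure.restrict_univ]
  unfold IntegrableOn at hi
  rw [hμ] at hi ⊢
  have hmp : MeasurePreserving (fun z : ℝ × ℝ => (-q - z.1, z.2))
      ((volume : Measure ℝ).prod (volume.restrict (Ioi 0)))
      ((volume : Measure ℝ).prod (volume.restrict (Ioi 0))) :=
    (Measure.measurePreserving_sub_left volume (-q)).prod (MeasurePreserving.id _)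
  have hemb : MeasurableEmbedding (fun z : ℝ × ℝ => (-q - z.1, z.2)) :=
    ((MeasurableEquiv.subLeft (-q)).prodCongr (.refl ℝ)).measurableEmbedding
  have hi' := (hmp.integrable_comp_emb hemb).2 hi
  have he := hmp.integral_comp hemb (fun z : ℝ × ℝ => z.2 ^ b * loopHalf D p q z.1 z.2)
  simp_rw [mul_add]
  rw [integral_add hi (by exact hi'), he]
  ring

/-! ### The prefactor, the coefficient and the conclusion. -/

/-- The factor in front of the `ε`-dependent integral. -/
noncomputable def loopPrefactor (D ε : ℝ) : ℝ :=
  1 / (2 * π) ^ (4 - 2 * D + 2 * ε) * (π ^ (3 / 2 - D + ε) / Gamma (5 / 2 - D + ε)) *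
    (1 / (2 * π) ^ D * (π ^ (D / 2) * Gamma (2 - D / 2)) * (4 - D)) * 2

theorem feynmanI_eq {D p q ε : ℝ} (hD0 : 0 < D) (hD4 : D < 4)
    (hi : IntegrableOn (fun z : ℝ × ℝ => z.2 ^ (3 / 2 - D + ε) * loopHalf D p q z.1 z.2)
      (univ ×ˢ Ioi 0)) :
    feynmanI D (4 - 2 * D + 2 * ε) p q = loopPrefactor D ε *
      ∫ z in (univ : Set ℝ) ×ˢ Ioi (0 : ℝ), z.2 ^ (3 / 2 - D + ε) * loopHalf D p q z.1 z.2 := by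
  have hms : MeasurableSet ((univ : Set ℝ) ×ˢ Ioi (0 : ℝ)) := MeasurableSet.univ.prod measurableSet_Ioi
  rw [feynmanI, dimIntegral, show (4 - 2 * D + 2 * ε - 1) / 2 = 3 / 2 - D + ε by ring,
    show (4 - 2 * D + 2 * ε + 1) / 2 = 5 / 2 - D + ε by ring]
  have : ∀ z ∈ (univ : Set ℝ) ×ˢ Ioi (0 : ℝ), z.2 ^ (3 / 2 - D + ε) *
      deriv (fun v => 1 / (2 * π) ^ D *
        dimIntegral D (fun x u => feynmanIntegrand p q x u z.1 v)) z.2 =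
      (-(1 / (2 * π) ^ D * (π ^ (D / 2) * Gamma (2 - D / 2)) * (4 - D))) *
        (z.2 ^ (3 / 2 - D + ε) * (loopHalf D p q z.1 z.2 + loopHalf D p q (-q - z.1) z.2)) :=
    fun z hz => by
      rw [deriv_dimIntegral_feynmanIntegrand hD0 hD4 p q z.1 hz.2]
      ring
  rw [setIntegral_congr_fun hms this, integral_const_mul, integral_loopHalf_reflect hi,
    loopPrefactor]
  ring

theorem differentiableAt_loopPrefactor {D : ℝ} (hD2 : D < 2) :
    DifferentiableAt ℝ (loopPrefactor D) 0 := by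
  have h5 : 0 < 5 / 2 - D + 0 := by linarith
  have hG : DifferentiableAt ℝ (fun ε => Gamma (5 / 2 - D + ε)) 0 := by
    refine DifferentiableAt.comp (g := Gamma) (0 : ℝ) (differentiableAt_Gamma fun m => ?_)
      (by fun_prop)
    have : (0 : ℝ) ≤ m := m.cast_nonneg
    linarith
  have h1 : DifferentiableAt ℝ (fun ε : ℝ => (2 * π) ^ (4 - 2 * D + 2 * ε)) 0 :=
    (differentiableAt_const _).rpow (by fun_prop) (by positivity)
  have h2 : DifferentiableAt ℝ (fun ε : ℝ => π ^ (3 / 2 - D + ε)) 0 :=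
    (differentiableAt_const _).rpow (by fun_prop) (by positivity)
  have h3 := (Gamma_pos_of_pos h5).ne'
  have h4 : (2 * π) ^ (4 - 2 * D + 2 * 0) ≠ 0 := by positivity
  unfold loopPrefactor
  exact ((((differentiableAt_const _).fun_div h1 h4).fun_mul (h2.fun_div hG h3)).mul_const _).mul_const _

theorem loopPrefactor_zero_mul {D : ℝ} (hD2 : D < 2) :
    loopPrefactor D 0 * (√π * Gamma (5 / 2 - D) / Gamma (3 - D) / (2 - D / 2)) =
      lowerBoundaryCoeff D := by
  have h1 := (Gamma_pos_of_pos (show 0 < 5 / 2 - D by linarith)).ne'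
  have h2 := (Gamma_pos_of_pos (show 0 < 3 / 2 - D / 2 by linarith)).ne'
  have h3 := (Gamma_pos_of_pos (show 0 < 2 - D / 2 by linarith)).ne'
  have h6 : 2 - D / 2 ≠ 0 := by linarith
  -- Duplication splits `Γ(3 - D)`, whose factor `Γ(2 - D/2)` cancels the one from the `p'`
  -- integral.
  have hdup := Gamma_mul_Gamma_add_half (3 / 2 - D / 2)
  rw [show 3 / 2 - D / 2 + 1 / 2 = 2 - D / 2 by ring, show 2 * (3 / 2 - D / 2) = 3 - D by ring,
    show 1 - (3 - D) = D - 2 by ring] at hdup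
  have h2D : (2 : ℝ) ^ (D - 2) ≠ 0 := by positivity
  have hsp : √π ≠ 0 := by positivity
  have h3D : Gamma (3 - D) =
      Gamma (3 / 2 - D / 2) * Gamma (2 - D / 2) / (2 ^ (D - 2) * √π) := by
    rw [hdup]; field_simp
  have h16 : (16 * π) ^ ((D - 3) / 2) = 2 ^ (2 * D - 6) * π ^ (D / 2 - 3 / 2) := by
    rw [mul_rpow (by norm_num) pi_pos.le, show (16 : ℝ) = 2 ^ (4 : ℝ) by norm_num,
      ← rpow_mul zero_le_two]
    ring_nf
  have hpow : 1 / (2 * π) ^ (4 - 2 * D) * π ^ (3 / 2 - D) * (1 / (2 * π) ^ D * π ^ (D / 2)) * π *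
      2 ^ (D - 2) = 2 ^ (2 * D - 6) * π ^ (D / 2 - 3 / 2) := by
    rw [mul_rpow zero_le_two pi_pos.le, mul_rpow zero_le_two pi_pos.le, one_div, one_div, mul_inv,
      mul_inv, ← rpow_neg zero_le_two, ← rpow_neg zero_le_two, ← rpow_neg pi_pos.le,
      ← rpow_neg pi_pos.le]
    nth_rewrite 5 [← rpow_one π]
    rw [show 2 * D - 6 = -(4 - 2 * D) + -D + (D - 2) by ring,
      show D / 2 - 3 / 2 = -(4 - 2 * D) + (3 / 2 - D) + -D + D / 2 + 1 by ring]
    simp only [rpow_add two_pos, rpow_add pi_pos]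
    ring
  rw [lowerBoundaryCoeff, h16, ← hpow, loopPrefactor, h3D, mul_zero, add_zero, add_zero, add_zero]
  have h7 : 4 - D = 2 * (2 - D / 2) := by ring
  rw [h7]
  generalize 2 - D / 2 = d at h3 h6 ⊢
  generalize (2 : ℝ) ^ (D - 2) = a at h2D ⊢
  generalize (1 : ℝ) / (2 * π) ^ (4 - 2 * D) = b
  generalize (1 : ℝ) / (2 * π) ^ D = e
  generalize Gamma (5 / 2 - D) = g at h1 ⊢
  generalize Gamma (3 / 2 - D / 2) = g' at h2 ⊢
  have hpi2 : √π ^ 2 = π := sq_sqrt pi_pos.le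
  field_simp
  rw [hpi2]
  ring

theorem mainTheorem10 (D : ℝ) (hD0 : 0 < D) (hD2 : D < 2)
    (p q : ℝ) (hp : 0 ≤ p) (hq : 0 ≤ q) (hpq : 0 < p ∨ 0 < q) :
    Asymptotics.IsBigO (nhdsWithin (0 : ℝ) (Set.Ioi 0))
      (fun ε : ℝ => feynmanI D (4 - 2 * D + 2 * ε) p q
        - lowerBoundaryCoeff D / (ε * (p ^ 2 + q ^ 4)))
      (fun _ : ℝ => (1 : ℝ)) := by
  have hS : 0 < p ^ 2 + q ^ 4 := by rcases hpq with h | h <;> positivity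
  obtain ⟨C, hC⟩ := exists_bound_integral_loopHalf hD2 hq hS
  set c := √π * Gamma (5 / 2 - D) / Gamma (3 - D) / (2 - D / 2) with hc
  have hdiff := differentiableAt_loopPrefactor hD2
  have hmem : Ioc (0 : ℝ) 1 ∈ 𝓝[>] (0 : ℝ) := Ioc_mem_nhdsGT one_pos
  have h1 : (fun ε => (∫ z in (univ : Set ℝ) ×ˢ Ioi (0 : ℝ),
      z.2 ^ (3 / 2 - D + ε) * loopHalf D p q z.1 z.2) - c / (p ^ 2 + q ^ 4) / ε)
      =O[𝓝[>] (0 : ℝ)] fun _ => (1 : ℝ) := by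
    refine .of_bound C ?_
    filter_upwards [hmem] with ε hε
    rw [norm_one, mul_one, Real.norm_eq_abs]
    exact (hC ε hε.1 hε.2).2
  have h2 : loopPrefactor D =O[𝓝[>] (0 : ℝ)] fun _ => (1 : ℝ) :=
    (hdiff.continuousAt.tendsto.mono_left nhdsWithin_le_nhds).isBigO_one ℝ
  -- Differentiability makes the prefactor's increment `O(ε)`, which cancels the pole.
  have h3 : (fun ε => (loopPrefactor D ε - loopPrefactor D 0) * (c / (p ^ 2 + q ^ 4) * ε⁻¹))
      =O[𝓝[>] (0 : ℝ)] fun _ => (1 : ℝ) := by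
    have h4 := hdiff.isBigO_sub.mono (nhdsWithin_le_nhds (s := Ioi 0))
    have h5 := h4.mul ((Asymptotics.isBigO_refl (fun ε : ℝ => ε⁻¹) (𝓝[>] 0)).const_mul_left
      (c / (p ^ 2 + q ^ 4)))
    refine h5.trans (.of_bound 1 ?_)
    filter_upwards [hmem] with ε hε
    rw [sub_zero, mul_inv_cancel₀ hε.1.ne']
    simp
  have h6 := (h2.mul h1).add (h3.congr_right fun _ => (mul_one (1 : ℝ)).symm)
  refine h6.congr' ?_ (.of_forall fun _ => mul_one 1)
  filter_upwards [hmem] with ε hε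
  rw [feynmanI_eq hD0 (by linarith) (hC ε hε.1 hε.2).1, ← loopPrefactor_zero_mul hD2]
  rw [← hc]
  have := hε.1.ne'
  field_simp
  ring
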